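/- Let $\mathsf X$ be a non-compact Polish space with its Borel $\sigma$-algebra, $\mu$ a probability measure on $\mathsf X$, $(M_n)_{n\ge1}$ Markov kernels on $\mathsf X$, and $(G_n)_{n\ge0}$ measurable, strictly positive functions on $\mathsf X$. Put $Q_n(x,dx'):=G_{n-1}(x)M_n(x,dx')$ for $n\ge1$, and $\gamma_n:=\mu Q_1\cdots Q_n$ (with $\gamma_0:=\mu$). For $N\ge1$, the $N$-particle system is the $\mathsf X^N$-valued Markov chain $(\xi_n)_{n\ge0}$ such that $\xi_0^1,\dots,\xi_0^N$ are i.i.d. with law $\mu$ and, given $\xi_0,\dots,\xi_{n-1}$, the variables $\xi_n^1,\dots,\xi_n^N$ are i.i.d. with law $\eta_{n-1}^NQ_n/\eta_{n-1}^N(G_{n-1})$, where $\eta_n^N:=N^{-1}\sum_{i=1}^N\delta_{\xi_n^i}$. Put $\gamma_n^N:=\bigl[\prod_{p=0}^{n-1}\eta_p^N(G_p)\bigr]\eta_n^N$, and write $\mathbb E_\mu$ for the expectation with respect to the law of this chain. Let $V:\mathsf X\to[1,\infty)$ be measurable and unbounded, $v:=e^V$, $C_d:=\{x:V(x)\le d\}$,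 $\delta>0$ and $\underline d\ge1$, and assume: (H1) for each $d\ge\underline d$ there is $b_d<\infty$ with $\sup_{n\ge1}Q_n(e^V)(x)\le \exp\bigl(V(x)(1-\delta)+b_d\mathbb I_{C_d}(x)\bigr)$ for all $x\in\mathsf X$; (H2) $\mu(v)<\infty$; (H3) for each $d\ge\underline d$: $Q_n(x,C_d)>0$ for all $x\in\mathsf X$ and $n\ge1$, and there are $\epsilon_d^->0$ and a probability measure $\nu_d$ with $\nu_d(v)<\infty$ such that $\inf_{n\ge1}Q_n(x,C_d\cap A)\ge\epsilon_d^-\nu_d(C_d\cap A)$ for all $x\in C_d$ and all Borel sets $A$, and $\nu_d(C_r)>0$ for all $r\in[\underline d,d]$; (H4) for each $d\ge\underline d$ there is $\epsilon_d^+\in[\epsilon_d^-,\infty)$ such that $\sup_{n\ge1}Q_n(x,C_d\cap A)\le\epsilon_d^+\nu_d(C_d\cap A)$ for all $x\in C_d$ and all Borel sets $A$; (H5) $\sup_{n\ge0}\sup_{x\in\mathsf X}G_n(x)\le\bar G<\infty$. Then there is a finite constant $c_\mu>0$, depending only on $\mu$ and the quantities $V,\delta,\underline d,(b_d),(\epsilon_d^-),(\epsilon_d^+),(\nu_d),\bar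 G$ in (H1)–(H5) (and not otherwise on $(M_n)$, $(G_n)$, nor on $n$ and $N$), such that for all $n\ge1$ and $N\ge1$, $$N>c_\mu(n+1)\quad\Longrightarrow\quad \mathbb E_\mu\left[\left(\frac{\gamma_n^N(1)}{\gamma_n(1)}-1\right)^2\right]\le c_\mu\,\frac{4}{N}\,(n+1)\,\mu(v)^2,$$ where the expectation on the left is that of an integrable random variable. -/

import Mathlib

open MeasureTheory ProbabilityTheory
open scoped ENNReal

noncomputable section

namespace ParticleFK

/-- The data of a non-homogeneous Feynman-Kac model on `X`: Markov kernels `M n`, `n ≥ 1`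
(the kernel `M 0` is never used), and measurable, strictly positive potentials `G n`, `n ≥ 0`. -/
structure Model (X : Type*) [MeasurableSpace X] where
  /-- The Markov kernels. -/
  M : ℕ → Kernel X X
  /-- The potential functions. -/
  G : ℕ → X → ℝ
  markov : ∀ n, IsMarkovKernel (M n)
  measurable_G : ∀ n, Measurable (G n)
  G_pos : ∀ n x, 0 < G n x

attribute [instance] Model.markov

variable {X : Type*} [MeasurableSpace X]

/-- The integral kernel `Q_n(x, dx') = G_{n-1}(x) M_n(x, dx')`, used for `n ≥ 1`. -/
def Model.Q (F : Model X) (n : ℕ) : Kernel X X where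
  toFun x := ENNReal.ofReal (F.G (n - 1) x) • F.M n x
  measurable' := by
    refine Measure.measurable_of_measurable_coe _ fun s hs => ?_
    simp only [Measure.smul_apply, smul_eq_mul]
    exact (F.measurable_G (n - 1)).ennreal_ofReal.mul ((F.M n).measurable_coe hs)

/-- The semigroup from time `0`: `Q_{0,0} = Id` and `Q_{0,n+1} = Q_1 ⋯ Q_n Q_{n+1}`. -/
def Model.Q₀ (F : Model X) : ℕ → Kernel X X
  | 0 => Kernel.id
  | n + 1 => F.Q (n + 1) ∘ₖ F.Q₀ n

/-- The unnormalized Feynman-Kac measures `γ_n = μ Q_{0,n}`. -/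
def Model.gamma (F : Model X) (μ : Measure X) (n : ℕ) : Measure X :=
  μ.bind (F.Q₀ n)

/-- The empirical measure `N⁻¹ ∑ᵢ δ_{ξⁱ}` of a population `ξ`. -/
def empirical {N : ℕ} (ξ : Fin N → X) : Measure X :=
  (N : ℝ≥0∞)⁻¹ • ∑ i, Measure.dirac (ξ i)

/-- `selMut F n ξ` is the law `η Q_n / η(G_{n-1})` with `η` the empirical measure of `ξ`: each
particle of time `n ≥ 1` is drawn from it when the population at time `n - 1` is `ξ`. -/
def Model.selMut (F : Model X) {N : ℕ} (n : ℕ) (ξ : Fin N → X) : Measure X :=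
  (∫⁻ x, ENNReal.ofReal (F.G (n - 1) x) ∂(empirical ξ))⁻¹ • (empirical ξ).bind (F.Q n)

lemma measurable_empirical {N : ℕ} : Measurable (empirical : (Fin N → X) → Measure X) := by
  refine Measure.measurable_of_measurable_coe _ fun s hs => ?_
  simp only [empirical, Measure.smul_apply, smul_eq_mul, Measure.finsetSum_apply]
  refine Measurable.const_mul (Finset.measurable_sum _ fun i _ => ?_) _
  exact (Measure.measurable_coe hs).comp (Measure.measurable_dirac.comp (measurable_pi_apply i))

instance {N : ℕ} [NeZero N] (ξ : Fin N → X) : IsProbabilityMeasure (empirical ξ) := by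
  refine ⟨?_⟩
  simp only [empirical, Measure.smul_apply, smul_eq_mul, Measure.finsetSum_apply, measure_univ,
    Finset.sum_const, Finset.card_univ, Fintype.card_fin, nsmul_eq_mul, mul_one]
  exact ENNReal.inv_mul_cancel (by simp [NeZero.ne N]) (by simp)

lemma Model.measurable_selMut (F : Model X) {N : ℕ} (n : ℕ) :
    Measurable (F.selMut n : (Fin N → X) → Measure X) := by
  have h1 : Measurable fun ξ : Fin N → X => (empirical ξ).bind (F.Q n) :=
    (Measure.measurable_bind' (F.Q n).measurable).comp measurable_empirical
  have h2 : Measurable fun ξ : Fin N → X =>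
      ∫⁻ x, ENNReal.ofReal (F.G (n - 1) x) ∂(empirical ξ) :=
    (Measure.measurable_lintegral (F.measurable_G (n - 1)).ennreal_ofReal).comp
      measurable_empirical
  refine Measure.measurable_of_measurable_coe _ fun s hs => ?_
  simp only [Model.selMut, Measure.smul_apply, smul_eq_mul]
  exact h2.inv.mul ((Measure.measurable_coe hs).comp h1)

lemma lintegral_empirical {N : ℕ} (ξ : Fin N → X) {f : X → ℝ≥0∞} (hf : Measurable f) :
    ∫⁻ x, f x ∂(empirical ξ) = (N : ℝ≥0∞)⁻¹ * ∑ i, f (ξ i) := by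
  simp [empirical, lintegral_smul_measure, lintegral_finsetSum_measure, lintegral_dirac' _ hf]

instance (F : Model X) {N : ℕ} [NeZero N] (n : ℕ) (ξ : Fin N → X) :
    IsProbabilityMeasure (F.selMut n ξ) := by
  refine ⟨?_⟩
  have hG : Measurable fun x => ENNReal.ofReal (F.G (n - 1) x) :=
    (F.measurable_G (n - 1)).ennreal_ofReal
  have hb : (empirical ξ).bind (F.Q n) Set.univ
      = ∫⁻ x, ENNReal.ofReal (F.G (n - 1) x) ∂(empirical ξ) := by
    rw [Measure.bind_apply MeasurableSet.univ (F.Q n).aemeasurable]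
    refine lintegral_congr fun x => ?_
    change (ENNReal.ofReal (F.G (n - 1) x) • F.M n x) Set.univ = _
    simp
  rw [Model.selMut, Measure.smul_apply, smul_eq_mul, hb]
  refine ENNReal.inv_mul_cancel ?_ ?_
  · rw [lintegral_empirical ξ hG]
    refine mul_ne_zero (by simp) ?_
    have h0 : ENNReal.ofReal (F.G (n - 1) (ξ 0)) ≠ 0 := by
      simpa using F.G_pos (n - 1) (ξ 0)
    intro h
    exact h0 ((Finset.sum_eq_zero_iff.1 h) 0 (Finset.mem_univ _))
  · rw [lintegral_empirical ξ hG]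
    refine ENNReal.mul_ne_top (by simp [NeZero.ne N]) ?_
    exact ENNReal.sum_ne_top.2 fun i _ => ENNReal.ofReal_ne_top

/-- The transition kernel of the `N`-particle system from time `n - 1` to time `n`, `n ≥ 1`: given
`ξ`, the `N` new particles are independent with common law `selMut F n ξ`. -/
def Model.step (F : Model X) (N : ℕ) [NeZero N] (n : ℕ) : Kernel (Fin N → X) (Fin N → X) where
  toFun ξ := Measure.pi fun _ => F.selMut n ξ
  measurable' := by
    refine Measurable.measure_of_isPiSystem_of_isProbabilityMeasure
      generateFrom_pi.symm isPiSystem_pi ?_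
    rintro _ ⟨t, ht, rfl⟩
    have ht' : ∀ i, MeasurableSet (t i) := fun i => ht i (Set.mem_univ i)
    simp only [Measure.pi_pi]
    exact Finset.measurable_prod _ fun i _ =>
      (Measure.measurable_coe (ht' i)).comp (F.measurable_selMut n)

instance (F : Model X) (N : ℕ) [NeZero N] (n : ℕ) : IsMarkovKernel (F.step N n) := by
  refine ⟨fun ξ => ?_⟩
  change IsProbabilityMeasure (Measure.pi fun _ => F.selMut n ξ)
  infer_instance

/-- The law, on the space of population trajectories, of the `N`-particle system initialized
from `μ`: the Markov chain with initial law `μ^{⊗N}` and transition kernels `step`. -/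
def Model.particleLaw (F : Model X) (μ : Measure X) [IsProbabilityMeasure μ] (N : ℕ) [NeZero N] :
    Measure (ℕ → Fin N → X) :=
  Kernel.trajMeasure (X := fun _ => Fin N → X) (Measure.pi fun _ => μ) fun n =>
    (F.step N (n + 1)).comap (fun h => h ⟨n, by simp⟩) (measurable_pi_apply _)

/-- The particle approximation `γ_n^N = (∏_{p<n} η_p^N(G_p)) η_n^N` along the trajectory `ω`. -/
def Model.gammaN (F : Model X) {N : ℕ} (n : ℕ) (ω : ℕ → Fin N → X) : Measure X :=
  (∏ p ∈ Finset.range n, ∫⁻ x, ENNReal.ofReal (F.G p x) ∂(empirical (ω p))) • empirical (ω n)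

/-- The sublevel set `C_d = {V ≤ d}`. -/
def sublevel (V : X → ℝ) (d : ℝ) : Set X := {x | V x ≤ d}

/-- `η ∈ 𝒫_v` for `v = e^V`: a probability measure with `η(v) < ∞`. -/
def MemPv (V : X → ℝ) (η : Measure X) : Prop :=
  IsProbabilityMeasure η ∧ ∫⁻ x, ENNReal.ofReal (Real.exp (V x)) ∂η < ∞

/-- Multiplicative drift condition, with drift function `V`, constants `δ`, `dlow` and `b_d`. -/
structure Model.Drift (F : Model X) (V : X → ℝ) (δ dlow : ℝ) (b : ℝ → ℝ) : Prop where
  measurable : Measurable V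
  one_le : ∀ x, 1 ≤ V x
  unbounded : ¬ BddAbove (Set.range V)
  delta_pos : 0 < δ
  one_le_dlow : 1 ≤ dlow
  drift : ∀ d, dlow ≤ d → ∀ n, 1 ≤ n → ∀ x,
    ∫⁻ y, ENNReal.ofReal (Real.exp (V y)) ∂(F.Q n x) ≤
      ENNReal.ofReal (Real.exp (V x * (1 - δ) + b d * (sublevel V d).indicator (fun _ => 1) x))

/-- Accessibility of the sets `C_d` and local minorization on them. -/
structure Model.Minor (F : Model X) (V : X → ℝ) (dlow : ℝ) (εm : ℝ → ℝ) (ν : ℝ → Measure X) :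
    Prop where
  accessible : ∀ d, dlow ≤ d → ∀ n, 1 ≤ n → ∀ x, 0 < F.Q n x (sublevel V d)
  eps_pos : ∀ d, dlow ≤ d → 0 < εm d
  mem_Pv : ∀ d, dlow ≤ d → MemPv V (ν d)
  minor : ∀ d, dlow ≤ d → ∀ n, 1 ≤ n → ∀ x ∈ sublevel V d, ∀ A, MeasurableSet A →
    ENNReal.ofReal (εm d) * ν d (sublevel V d ∩ A) ≤ F.Q n x (sublevel V d ∩ A)
  charge : ∀ d, dlow ≤ d → ∀ r ∈ Set.Icc dlow d, 0 < ν d (sublevel V r)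

/-- Local majorization on the sets `C_d`, with the same measures `ν_d`. -/
structure Model.Major (F : Model X) (V : X → ℝ) (dlow : ℝ) (εm εp : ℝ → ℝ) (ν : ℝ → Measure X) :
    Prop where
  eps_le : ∀ d, dlow ≤ d → εm d ≤ εp d
  major : ∀ d, dlow ≤ d → ∀ n, 1 ≤ n → ∀ x ∈ sublevel V d, ∀ A, MeasurableSet A →
    F.Q n x (sublevel V d ∩ A) ≤ ENNReal.ofReal (εp d) * ν d (sublevel V d ∩ A)

/-- The potentials are bounded by `Gbar`, uniformly in time and space. -/
def Model.BoundedBy (F : Model X) (Gbar : ℝ) : Prop := ∀ n x, F.G n x ≤ Gbar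

end ParticleFK

end

/-! The estimate `γ_n^N(1)` is unbiased, so its relative variance is the relative second moment
minus one. Conditioning generation by generation, two lineages traced backwards either never
coalesce, which gives at most `γ_n(1)^2`, or meet at some time `q`. Hence (`Model.moment_le_sum`)
the excess is at most `N⁻¹ ∑_{q ≤ n} coal_q((Q_{q,n} 1)^2)`, where `coal_0(u) = μ(u)` and `coal_q(u)
= E[γ_{q-1}^N(Q_q 1) γ_{q-1}^N(Q_q u)]`.

It suffices that each term be `O(γ_n(1)^2)`. Two facts about the deterministic flow give this.
Tightness (`Model.exists_gamma_tight`): `γ_p(v)` is at most a constant times `γ_p(C_r)`, by drift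
and minorization. Stability (`Model.exists_sg_expV_le`): for small powers `w = e^{βV}`, `γ_j(1)
Q_{j,j+k}(w) ≤ E w γ_{j+k}(w)` with `E` independent of time, by comparing with `ν_d` on a large
`C_d` and using the drift elsewhere.

The coalescence terms are again second moments of the particle system, now with the unbounded
function `w = e^{V/2}`, so the estimate must close on itself. It does because `Q_{q,n} 1` grows only
like a small power `e^{δ'V/2}`, while one step of the drift lowers `Q_{q,n} w` to `e^{(1-δ')V/2}`;
the product is `w` again. An induction on `q` (`Model.moment_one_le`) then bounds `coal_q(w)` by `2T
γ_q(1)^2`, as long as `N` exceeds a multiple of `n + 1`. -/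

noncomputable section

namespace ParticleFK

variable {X : Type*}

/-! ### Exponential weights. -/

/-- The function `e^{βV}`, with values in `[0,∞]`. -/
def expV (V : X → ℝ) (β : ℝ) (x : X) : ℝ≥0∞ := ENNReal.ofReal (Real.exp (β * V x))

lemma expV_mul (V : X → ℝ) (β β' : ℝ) (x : X) :
    expV V β x * expV V β' x = expV V (β + β') x := by
  rw [expV, expV, expV, ← ENNReal.ofReal_mul (Real.exp_pos _).le, ← Real.exp_add, add_mul]

lemma expV_mono {V : X → ℝ} (h1 : ∀ x, 1 ≤ V x) {β β' : ℝ} (h : β ≤ β') :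
    expV V β ≤ expV V β' := fun x => by
  have := h1 x
  exact ENNReal.ofReal_le_ofReal (Real.exp_le_exp.2 (by nlinarith))

lemma one_le_expV {V : X → ℝ} (h1 : ∀ x, 1 ≤ V x) {β : ℝ} (h : 0 ≤ β) (x : X) :
    1 ≤ expV V β x := by
  have := h1 x
  rw [← ENNReal.ofReal_one]
  exact ENNReal.ofReal_le_ofReal (Real.one_le_exp (by nlinarith))

lemma sublevel_mono (V : X → ℝ) {d d' : ℝ} (h : d ≤ d') : sublevel V d ⊆ sublevel V d' :=
  fun _ hx => le_trans hx h

lemma exists_ofReal_exp_neg_mul_le {η : ℝ} (hη : 0 < η) {K t : ℝ≥0∞} (hK : K ≠ ∞) (ht : t ≠ 0)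
    (d₀ : ℝ) : ∃ d, d₀ ≤ d ∧ K * ENNReal.ofReal (Real.exp (-(η * d))) ≤ t := by
  have h1 : Filter.Tendsto (fun d : ℝ => Real.exp (-(η * d))) Filter.atTop (nhds 0) :=
    Real.tendsto_exp_atBot.comp
      (Filter.tendsto_neg_atTop_atBot.comp (Filter.tendsto_id.const_mul_atTop hη))
  have h2 := ENNReal.Tendsto.const_mul (a := K) (ENNReal.tendsto_ofReal h1) (Or.inr hK)
  rw [ENNReal.ofReal_zero, mul_zero] at h2
  have h3 := h2.eventually_lt_const (pos_iff_ne_zero.2 ht)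
  obtain ⟨d, hd, hd'⟩ := (h3.and (Filter.eventually_ge_atTop d₀)).exists
  exact ⟨d, hd', hd.le⟩

variable [MeasurableSpace X]

/-! ### The Feynman-Kac semigroup and flow on nonnegative functions. -/

/-- The action `f ↦ Q_n(f)` of the integral kernel on nonnegative functions. -/
def Model.Qf (F : Model X) (n : ℕ) (f : X → ℝ≥0∞) (x : X) : ℝ≥0∞ := ∫⁻ y, f y ∂(F.Q n x)

lemma Model.measurable_Qf (F : Model X) (n : ℕ) {f : X → ℝ≥0∞} (hf : Measurable f) :
    Measurable (F.Qf n f) := hf.lintegral_kernel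

lemma Model.Qf_mono (F : Model X) (n : ℕ) {f g : X → ℝ≥0∞} (h : f ≤ g) :
    F.Qf n f ≤ F.Qf n g := fun _ => lintegral_mono h

lemma Model.Qf_one (F : Model X) (n : ℕ) (x : X) :
    F.Qf n 1 x = ENNReal.ofReal (F.G (n - 1) x) := by
  have h : F.Q n x = ENNReal.ofReal (F.G (n - 1) x) • F.M n x := rfl
  simp [Qf, h]

lemma Model.Qf_const_mul (F : Model X) (n : ℕ) (c : ℝ≥0∞) {f : X → ℝ≥0∞} (hf : Measurable f)
    (x : X) : F.Qf n (fun y => c * f y) x = c * F.Qf n f x := lintegral_const_mul c hf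

/-- The semigroup `Q_{p,p+k}` acting on nonnegative functions. -/
def Model.sg (F : Model X) : ℕ → ℕ → (X → ℝ≥0∞) → X → ℝ≥0∞
  | _, 0, f => f
  | p, k + 1, f => F.Qf (p + 1) (F.sg (p + 1) k f)

lemma Model.measurable_sg (F : Model X) (p k : ℕ) {f : X → ℝ≥0∞} (hf : Measurable f) :
    Measurable (F.sg p k f) := by
  induction k generalizing p with
  | zero => exact hf
  | succ k ih => exact F.measurable_Qf _ (ih _)

lemma Model.sg_mono (F : Model X) (p k : ℕ) {f g : X → ℝ≥0∞} (h : f ≤ g) :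
    F.sg p k f ≤ F.sg p k g := by
  induction k generalizing p with
  | zero => exact h
  | succ k ih => exact F.Qf_mono _ (ih _)

lemma Model.sg_Qf (F : Model X) (p k : ℕ) (f : X → ℝ≥0∞) :
    F.sg p k (F.Qf (p + k + 1) f) = F.sg p (k + 1) f := by
  induction k generalizing p with
  | zero => rfl
  | succ k ih =>
    have h := ih (p + 1)
    rw [show p + 1 + k + 1 = p + (k + 1) + 1 by ring] at h
    change F.Qf (p + 1) (F.sg (p + 1) k _) = F.Qf (p + 1) (F.sg (p + 1) (k + 1) f)
    rw [h]

section gamma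

variable (F : Model X) (μ : Measure X)

lemma Model.lintegral_gamma_zero (f : X → ℝ≥0∞) :
    ∫⁻ x, f x ∂(F.gamma μ 0) = ∫⁻ x, f x ∂μ := by
  have : F.gamma μ 0 = μ := by simp [Model.gamma, Model.Q₀]
  rw [this]

lemma Model.lintegral_gamma_succ (n : ℕ) {f : X → ℝ≥0∞} (hf : Measurable f) :
    ∫⁻ x, f x ∂(F.gamma μ (n + 1)) = ∫⁻ x, F.Qf (n + 1) f x ∂(F.gamma μ n) := by
  have h : F.gamma μ (n + 1) = μ.bind (F.Q (n + 1) ∘ₖ F.Q₀ n) := rfl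
  rw [h, Model.gamma, Measure.lintegral_bind (Kernel.aemeasurable _) hf.aemeasurable,
    Measure.lintegral_bind (Kernel.aemeasurable _) (F.measurable_Qf _ hf).aemeasurable]
  exact lintegral_congr fun x => Kernel.lintegral_comp _ _ _ hf

lemma Model.lintegral_gamma_sg (p k : ℕ) {f : X → ℝ≥0∞} (hf : Measurable f) :
    ∫⁻ x, F.sg p k f x ∂(F.gamma μ p) = ∫⁻ x, f x ∂(F.gamma μ (p + k)) := by
  induction k generalizing p with
  | zero => rfl
  | succ k ih =>
    rw [show p + (k + 1) = p + 1 + k by ring, ← ih (p + 1),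
      F.lintegral_gamma_succ μ p (F.measurable_sg _ _ hf)]
    rfl

end gamma

/-! ### The particle system: conditional moments and unbiasedness. -/

section chain

variable {N : ℕ}

lemma lintegral_pi_empirical [NeZero N] (ρ : Measure X) [IsProbabilityMeasure ρ]
    {f : X → ℝ≥0∞} (hf : Measurable f) :
    ∫⁻ ξ, (∫⁻ x, f x ∂(empirical ξ)) ∂(Measure.pi fun _ : Fin N => ρ) = ∫⁻ x, f x ∂ρ := by
  simp_rw [lintegral_empirical _ hf]
  rw [lintegral_const_mul _ (by fun_prop), lintegral_finsetSum _ (by fun_prop)]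
  have h : ∀ i : Fin N, ∫⁻ ξ : Fin N → X, f (ξ i) ∂(Measure.pi fun _ => ρ) = ∫⁻ x, f x ∂ρ :=
    fun i => (measurePreserving_eval (fun _ : Fin N => ρ) i).lintegral_comp hf
  simp only [h, Finset.sum_const, Finset.card_univ, Fintype.card_fin, nsmul_eq_mul]
  rw [← mul_assoc, ENNReal.inv_mul_cancel (by simp [NeZero.ne N]) (by simp), one_mul]

lemma lintegral_pi_empirical_mul_le [NeZero N] (ρ : Measure X) [IsProbabilityMeasure ρ]
    {f g : X → ℝ≥0∞} (hf : Measurable f) (hg : Measurable g) :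
    ∫⁻ ξ, (∫⁻ x, f x ∂(empirical ξ)) * (∫⁻ x, g x ∂(empirical ξ))
        ∂(Measure.pi fun _ : Fin N => ρ) ≤
      (∫⁻ x, f x ∂ρ) * (∫⁻ x, g x ∂ρ) + (N : ℝ≥0∞)⁻¹ * ∫⁻ x, f x * g x ∂ρ := by
  have hN : (N : ℝ≥0∞)⁻¹ * N = 1 :=
    ENNReal.inv_mul_cancel (by simp [NeZero.ne N]) (by simp)
  have he : ∀ {h : X → ℝ≥0∞}, Measurable h → ∀ i : Fin N,
      ∫⁻ ξ : Fin N → X, h (ξ i) ∂(Measure.pi fun _ => ρ) = ∫⁻ x, h x ∂ρ :=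
    fun hh i => (measurePreserving_eval (fun _ : Fin N => ρ) i).lintegral_comp hh
  have hij : ∀ i j : Fin N, ∫⁻ ξ : Fin N → X, f (ξ i) * g (ξ j) ∂(Measure.pi fun _ => ρ) ≤
      (∫⁻ x, f x ∂ρ) * (∫⁻ x, g x ∂ρ) + if i = j then ∫⁻ x, f x * g x ∂ρ else 0 := by
    intro i j
    -- On the diagonal the product of the means is not present but is added for free; this replaces
    -- the exact factor `1 - 1/N` by `1`, which is harmless for an upper bound.
    by_cases h : i = j
    · subst h
      rw [if_pos rfl, he (h := fun x => f x * g x) (hf.mul hg) i]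
      exact le_add_self
    · rw [if_neg h, add_zero]
      have hind : IndepFun (fun ξ : Fin N → X => ξ i) (fun ξ => ξ j)
          (Measure.pi fun _ => ρ) :=
        (iIndepFun_pi (μ := fun _ : Fin N => ρ) (X := fun _ => id)
          (fun _ => aemeasurable_id)).indepFun h
      have := lintegral_mul_eq_lintegral_mul_lintegral_of_indepFun
        (hf.comp (measurable_pi_apply i)) (hg.comp (measurable_pi_apply j)) (hind.comp hf hg)
      simp only [Pi.mul_apply, Function.comp_apply] at this
      rw [this, he hf, he hg]
  simp_rw [lintegral_empirical _ hf, lintegral_empirical _ hg]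
  calc
    _ = ∫⁻ ξ : Fin N → X, ((N : ℝ≥0∞)⁻¹ * (N : ℝ≥0∞)⁻¹) * ∑ i, ∑ j, f (ξ i) * g (ξ j)
        ∂(Measure.pi fun _ => ρ) := by
      refine lintegral_congr fun ξ => ?_
      rw [← Finset.sum_mul_sum]; ring
    _ = ((N : ℝ≥0∞)⁻¹ * (N : ℝ≥0∞)⁻¹) * ∑ i, ∑ j,
        ∫⁻ ξ : Fin N → X, f (ξ i) * g (ξ j) ∂(Measure.pi fun _ => ρ) := by
      rw [lintegral_const_mul _ (by fun_prop), lintegral_finsetSum _ (by fun_prop)]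
      simp_rw [fun i => lintegral_finsetSum (μ := Measure.pi fun _ : Fin N => ρ)
        (f := fun j (ξ : Fin N → X) => f (ξ i) * g (ξ j)) Finset.univ (by fun_prop)]
    _ ≤ ((N : ℝ≥0∞)⁻¹ * (N : ℝ≥0∞)⁻¹) * ∑ i : Fin N, ∑ j : Fin N,
        ((∫⁻ x, f x ∂ρ) * (∫⁻ x, g x ∂ρ) + if i = j then ∫⁻ x, f x * g x ∂ρ else 0) := by
      gcongr with i _ j _
      exact hij i j
    _ = ((N : ℝ≥0∞)⁻¹ * N) * ((N : ℝ≥0∞)⁻¹ * N) * ((∫⁻ x, f x ∂ρ) * (∫⁻ x, g x ∂ρ)) +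
        ((N : ℝ≥0∞)⁻¹ * N) * ((N : ℝ≥0∞)⁻¹ * ∫⁻ x, f x * g x ∂ρ) := by
      simp only [Finset.sum_add_distrib, Finset.sum_const, Finset.card_univ, Fintype.card_fin,
        nsmul_eq_mul, Finset.sum_ite_eq, Finset.mem_univ, if_true]
      ring
    _ = _ := by rw [hN]; ring

variable (F : Model X)

lemma Model.lintegral_selMut [NeZero N] (n : ℕ) (ξ : Fin N → X) {f : X → ℝ≥0∞}
    (hf : Measurable f) :
    (∫⁻ x, ENNReal.ofReal (F.G (n - 1) x) ∂(empirical ξ)) * ∫⁻ x, f x ∂(F.selMut n ξ) =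
      ∫⁻ x, F.Qf n f x ∂(empirical ξ) := by
  have hG : Measurable fun x => ENNReal.ofReal (F.G (n - 1) x) :=
    (F.measurable_G (n - 1)).ennreal_ofReal
  have h0 : ∫⁻ x, ENNReal.ofReal (F.G (n - 1) x) ∂(empirical ξ) ≠ 0 := by
    rw [lintegral_empirical ξ hG]
    refine mul_ne_zero (by simp) fun h => ?_
    have := (Finset.sum_eq_zero_iff.1 h) 0 (Finset.mem_univ _)
    simp only [ENNReal.ofReal_eq_zero] at this
    exact absurd this (not_le.2 (F.G_pos (n - 1) (ξ 0)))
  have ht : ∫⁻ x, ENNReal.ofReal (F.G (n - 1) x) ∂(empirical ξ) ≠ ∞ := by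
    rw [lintegral_empirical ξ hG]
    exact ENNReal.mul_ne_top (by simp [NeZero.ne N])
      (ENNReal.sum_ne_top.2 fun i _ => ENNReal.ofReal_ne_top)
  rw [Model.selMut, lintegral_smul_measure, smul_eq_mul, ← mul_assoc,
    ENNReal.mul_inv_cancel h0 ht, one_mul,
    Measure.lintegral_bind (Kernel.aemeasurable _) hf.aemeasurable]
  rfl

variable (μ : Measure X) [IsProbabilityMeasure μ]

instance [NeZero N] : IsProbabilityMeasure (F.particleLaw μ N) := by
  unfold Model.particleLaw; infer_instance

lemma Model.lintegral_particleLaw_zero [NeZero N] {g : (Fin N → X) → ℝ≥0∞} (hg : Measurable g) :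
    ∫⁻ ω, g (ω 0) ∂(F.particleLaw μ N) = ∫⁻ ξ, g ξ ∂(Measure.pi fun _ => μ) := by
  let κ : (n : ℕ) → Kernel ((i : Finset.Iic n) → (fun _ : ℕ => Fin N → X) i) (Fin N → X) :=
    fun n => (F.step N (n + 1)).comap (fun h => h ⟨n, by simp⟩) (measurable_pi_apply _)
  have hmeas : Measurable fun ω : (i : Finset.Iic 0) → Fin N → X => g (ω ⟨0, by simp⟩) :=
    hg.comp (measurable_pi_apply _)
  change ∫⁻ ω, g (ω 0) ∂(Kernel.trajMeasure (X := fun _ => Fin N → X) _ κ) = _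
  have hg0 : Measurable fun ω : ℕ → Fin N → X => g (ω 0) := hg.comp (measurable_pi_apply 0)
  rw [Kernel.trajMeasure, Measure.lintegral_bind (Kernel.aemeasurable _) hg0.aemeasurable]
  have h : ∀ x : (i : Finset.Iic 0) → Fin N → X,
      ∫⁻ ω, g (ω 0) ∂(Kernel.traj (X := fun _ => Fin N → X) κ 0 x) = g (x ⟨0, by simp⟩) := by
    intro x
    have h1 := Kernel.traj_map_frestrictLe_apply (X := fun _ => Fin N → X) (κ := κ) 0 0 x
    rw [Kernel.partialTraj_self, Kernel.id_apply] at h1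
    have h2 := congrArg (fun m => ∫⁻ y, g (y ⟨0, by simp⟩) ∂m) h1
    rw [lintegral_dirac' _ hmeas, lintegral_map hmeas (by fun_prop)] at h2
    exact h2
  rw [lintegral_congr h, lintegral_map hmeas (by fun_prop)]
  rfl

lemma Model.lintegral_particleLaw_succ [NeZero N] (n : ℕ)
    {Φ : ((i : Finset.Iic n) → Fin N → X) → ℝ≥0∞} (hΦ : Measurable Φ)
    {g : (Fin N → X) → ℝ≥0∞} (hg : Measurable g) :
    ∫⁻ ω, Φ (Preorder.frestrictLe n ω) * g (ω (n + 1)) ∂(F.particleLaw μ N) =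
      ∫⁻ ω, Φ (Preorder.frestrictLe n ω) *
        ∫⁻ ξ, g ξ ∂(Measure.pi fun _ => F.selMut (n + 1) (ω n)) ∂(F.particleLaw μ N) := by
  let κ : (n : ℕ) → Kernel ((i : Finset.Iic n) → (fun _ : ℕ => Fin N → X) i) (Fin N → X) :=
    fun n => (F.step N (n + 1)).comap (fun h => h ⟨n, by simp⟩) (measurable_pi_apply _)
  have key := Kernel.map_frestrictLe_trajMeasure_compProd_eq_map_trajMeasure
    (X := fun _ => Fin N → X) (κ := κ) (μ₀ := Measure.pi fun _ => μ) (a := n)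
  have hm : Measurable fun p : ((i : Finset.Iic n) → Fin N → X) × (Fin N → X) =>
      Φ p.1 * g p.2 := (hΦ.comp measurable_fst).mul (hg.comp measurable_snd)
  have h2 := congrArg (fun m => ∫⁻ p, Φ p.1 * g p.2 ∂m) key
  rw [Measure.lintegral_compProd hm, lintegral_map (hm.lintegral_kernel_prod_right') (by fun_prop),
    lintegral_map hm (by fun_prop)] at h2
  refine h2.symm.trans (lintegral_congr fun ω => ?_)
  exact lintegral_const_mul (μ := κ n (Preorder.frestrictLe n ω))
    (Φ (Preorder.frestrictLe n ω)) hg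

/-- The normalizing weight `∏_{p<n} η_p^N(G_p)`, as a function of the trajectory up to time `n`. -/
def Model.weight (n : ℕ) (ω : ℕ → Fin N → X) : ℝ≥0∞ :=
  ∏ p ∈ Finset.range n, ∫⁻ x, ENNReal.ofReal (F.G p x) ∂(empirical (ω p))

lemma measurable_lintegral_empirical {f : X → ℝ≥0∞} (hf : Measurable f) :
    Measurable fun ξ : Fin N → X => ∫⁻ x, f x ∂(empirical ξ) :=
  (Measure.measurable_lintegral hf).comp measurable_empirical

lemma Model.measurable_weight (n : ℕ) : Measurable (F.weight (N := N) n) :=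
  Finset.measurable_prod _ fun p _ =>
    (measurable_lintegral_empirical (F.measurable_G p).ennreal_ofReal).comp (measurable_pi_apply p)

lemma Model.lintegral_gammaN (n : ℕ) (ω : ℕ → Fin N → X) (f : X → ℝ≥0∞) :
    ∫⁻ x, f x ∂(F.gammaN n ω) = F.weight n ω * ∫⁻ x, f x ∂(empirical (ω n)) := by
  rw [Model.gammaN, lintegral_smul_measure]; rfl

lemma Model.measurable_lintegral_gammaN (n : ℕ) {f : X → ℝ≥0∞} (hf : Measurable f) :
    Measurable fun ω : ℕ → Fin N → X => ∫⁻ x, f x ∂(F.gammaN n ω) := by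
  simp_rw [F.lintegral_gammaN]
  exact (F.measurable_weight n).mul
    ((measurable_lintegral_empirical hf).comp (measurable_pi_apply n))

/-- Conditioning on the first `n` generations, for a function of generation `n + 1` weighted by
the normalizing factors. -/
lemma Model.lintegral_weight_mul [NeZero N] (n k : ℕ) {g : (Fin N → X) → ℝ≥0∞}
    (hg : Measurable g) :
    ∫⁻ ω, F.weight (n + 1) ω ^ k * g (ω (n + 1)) ∂(F.particleLaw μ N) =
      ∫⁻ ω, F.weight (n + 1) ω ^ k *
        ∫⁻ ξ, g ξ ∂(Measure.pi fun _ => F.selMut (n + 1) (ω n)) ∂(F.particleLaw μ N) := by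
  -- The weight at time `n + 1` involves generations `0, …, n` only, hence factors through the
  -- restricted trajectory; `attach` supplies the index bounds.
  let Φ : ((i : Finset.Iic n) → Fin N → X) → ℝ≥0∞ := fun h =>
    (∏ p ∈ (Finset.range (n + 1)).attach, ∫⁻ x, ENNReal.ofReal (F.G p x)
      ∂(empirical (h ⟨p, by have := Finset.mem_range.1 p.2; simp; omega⟩))) ^ k
  have hΦ : Measurable Φ := by
    refine (Finset.measurable_prod _ fun p _ => ?_).pow_const k
    exact (measurable_lintegral_empirical (F.measurable_G p).ennreal_ofReal).comp
      (measurable_pi_apply _)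
  have h : ∀ ω : ℕ → Fin N → X, F.weight (n + 1) ω ^ k = Φ (Preorder.frestrictLe n ω) := by
    intro ω
    simp only [Φ, Model.weight, Preorder.frestrictLe_apply]
    rw [Finset.prod_attach (Finset.range (n + 1))
      (fun p => ∫⁻ x, ENNReal.ofReal (F.G p x) ∂(empirical (ω p)))]
  simp_rw [h]
  exact F.lintegral_particleLaw_succ μ n hΦ hg

/-- The last factor of the weight cancels the normalizing constant of the selection law. This is why
the unnormalized measures have a linear one-step conditional mean. -/
lemma Model.weight_succ_mul_selMut [NeZero N] (n : ℕ) (ω : ℕ → Fin N → X) {f : X → ℝ≥0∞}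
    (hf : Measurable f) :
    F.weight (n + 1) ω * ∫⁻ x, f x ∂(F.selMut (n + 1) (ω n)) =
      ∫⁻ x, F.Qf (n + 1) f x ∂(F.gammaN n ω) := by
  rw [F.lintegral_gammaN, ← F.lintegral_selMut (n + 1) (ω n) hf, Model.weight,
    Finset.prod_range_succ, mul_assoc]
  rfl

lemma Model.lintegral_lintegral_gammaN [NeZero N] (n : ℕ) {f : X → ℝ≥0∞} (hf : Measurable f) :
    ∫⁻ ω, (∫⁻ x, f x ∂(F.gammaN n ω)) ∂(F.particleLaw μ N) = ∫⁻ x, f x ∂(F.gamma μ n) := by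
  induction n generalizing f with
  | zero =>
    simp_rw [F.lintegral_gammaN, Model.weight, Finset.range_zero, Finset.prod_empty, one_mul]
    rw [F.lintegral_particleLaw_zero μ (measurable_lintegral_empirical hf),
      lintegral_pi_empirical μ hf, F.lintegral_gamma_zero]
  | succ n ih =>
    have h := F.lintegral_weight_mul μ (N := N) n 1 (measurable_lintegral_empirical hf)
    simp only [pow_one] at h
    simp_rw [F.lintegral_gammaN]
    rw [h, F.lintegral_gamma_succ μ n hf, ← ih (F.measurable_Qf _ hf)]
    refine lintegral_congr fun ω => ?_
    rw [lintegral_pi_empirical _ hf, F.weight_succ_mul_selMut n ω hf]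

/-! ### Expansion of the second moments over coalescence times. -/

/-- The second moments `E[γ_n^N(f) γ_n^N(g)]` of the particle approximations. -/
def Model.moment (N : ℕ) [NeZero N] (n : ℕ) (f g : X → ℝ≥0∞) : ℝ≥0∞ :=
  ∫⁻ ω, (∫⁻ x, f x ∂(F.gammaN n ω)) * (∫⁻ x, g x ∂(F.gammaN n ω)) ∂(F.particleLaw μ N)

lemma Model.moment_mono [NeZero N] (n : ℕ) {f f' g g' : X → ℝ≥0∞} (hf : f ≤ f') (hg : g ≤ g') :
    F.moment μ N n f g ≤ F.moment μ N n f' g' :=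
  lintegral_mono fun _ => mul_le_mul' (lintegral_mono hf) (lintegral_mono hg)

lemma Model.moment_const_mul [NeZero N] (n : ℕ) {f g : X → ℝ≥0∞} (c : ℝ≥0∞)
    (hf : Measurable f) (hg : Measurable g) :
    F.moment μ N n f (fun x => c * g x) = c * F.moment μ N n f g := by
  unfold Model.moment
  have hm : Measurable fun ω : ℕ → Fin N → X =>
      (∫⁻ x, f x ∂(F.gammaN n ω)) * ∫⁻ x, g x ∂(F.gammaN n ω) :=
    (F.measurable_lintegral_gammaN n hf).mul (F.measurable_lintegral_gammaN n hg)
  rw [← lintegral_const_mul _ hm]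
  refine lintegral_congr fun ω => ?_
  rw [lintegral_const_mul _ hg]; ring

lemma Model.moment_zero_le [NeZero N] {f g : X → ℝ≥0∞} (hf : Measurable f) (hg : Measurable g) :
    F.moment μ N 0 f g ≤
      (∫⁻ x, f x ∂μ) * (∫⁻ x, g x ∂μ) + (N : ℝ≥0∞)⁻¹ * ∫⁻ x, f x * g x ∂μ := by
  simp_rw [Model.moment, F.lintegral_gammaN, Model.weight, Finset.range_zero, Finset.prod_empty,
    one_mul]
  rw [F.lintegral_particleLaw_zero μ (g := fun ξ : Fin N → X =>
    (∫⁻ x, f x ∂(empirical ξ)) * (∫⁻ x, g x ∂(empirical ξ)))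
    ((measurable_lintegral_empirical hf).mul (measurable_lintegral_empirical hg))]
  exact lintegral_pi_empirical_mul_le μ hf hg

/-- Given generation `n`, the new particles are independent. The squared weight cancels two
normalizations: off the diagonal one for each of `f` and `g`; on the diagonal `f * g` uses only one,
and the spare weight turns into `γ_n^N(Q_{n+1} 1)`. -/
lemma Model.moment_succ_le [NeZero N] (n : ℕ) {f g : X → ℝ≥0∞} (hf : Measurable f)
    (hg : Measurable g) :
    F.moment μ N (n + 1) f g ≤
      F.moment μ N n (F.Qf (n + 1) f) (F.Qf (n + 1) g) +
        (N : ℝ≥0∞)⁻¹ *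
          F.moment μ N n (F.Qf (n + 1) 1) (F.Qf (n + 1) (fun x => f x * g x)) := by
  have hfg : Measurable fun x => f x * g x := hf.mul hg
  have h := F.lintegral_weight_mul μ (N := N) n 2
    (g := fun ξ => (∫⁻ x, f x ∂(empirical ξ)) * ∫⁻ x, g x ∂(empirical ξ))
    ((measurable_lintegral_empirical hf).mul (measurable_lintegral_empirical hg))
  have hm : Measurable fun ω : ℕ → Fin N → X => (∫⁻ x, F.Qf (n + 1) 1 x ∂(F.gammaN n ω)) *
      ∫⁻ x, F.Qf (n + 1) (fun x => f x * g x) x ∂(F.gammaN n ω) :=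
    (F.measurable_lintegral_gammaN n (F.measurable_Qf _ measurable_one)).mul
      (F.measurable_lintegral_gammaN n (F.measurable_Qf _ hfg))
  have h0 : F.moment μ N (n + 1) f g = ∫⁻ ω, F.weight (n + 1) ω ^ 2 *
      ((∫⁻ x, f x ∂(empirical (ω (n + 1)))) * ∫⁻ x, g x ∂(empirical (ω (n + 1))))
        ∂(F.particleLaw μ N) := by
    refine lintegral_congr fun ω => ?_
    rw [F.lintegral_gammaN, F.lintegral_gammaN]; ring
  rw [h0, h]
  unfold Model.moment
  rw [← lintegral_const_mul _ hm, ← lintegral_add_right _ (hm.const_mul _)]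
  refine lintegral_mono fun ω => ?_
  refine (mul_le_mul_right (lintegral_pi_empirical_mul_le (N := N) (F.selMut (n + 1) (ω n)) hf hg)
    _).trans (le_of_eq ?_)
  rw [← F.weight_succ_mul_selMut n ω hf, ← F.weight_succ_mul_selMut n ω hg,
    ← F.weight_succ_mul_selMut n ω hfg, ← F.weight_succ_mul_selMut n ω measurable_one]
  simp only [Pi.one_apply, lintegral_one, measure_univ]
  ring

/-- The contribution to the second moments of a coalescence at time `q`: `μ(u)` if `q = 0`, and
`E[γ_{q-1}^N(Q_q 1) γ_{q-1}^N(Q_q u)]` otherwise. -/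
def Model.coal (N : ℕ) [NeZero N] : ℕ → (X → ℝ≥0∞) → ℝ≥0∞
  | 0, u => ∫⁻ x, u x ∂μ
  | q + 1, u => F.moment μ N q (F.Qf (q + 1) 1) (F.Qf (q + 1) u)

lemma Model.coal_le_mul [NeZero N] (q : ℕ) (c : ℝ≥0∞) {u w : X → ℝ≥0∞} (hw : Measurable w)
    (h : ∀ x, u x ≤ c * w x) : F.coal μ N q u ≤ c * F.coal μ N q w := by
  cases q with
  | zero => exact (lintegral_mono h).trans_eq (lintegral_const_mul c hw)
  | succ q =>
    change F.moment μ N q _ _ ≤ c * F.moment μ N q _ _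
    rw [← F.moment_const_mul μ q c (F.measurable_Qf _ measurable_one) (F.measurable_Qf _ hw)]
    refine F.moment_mono μ q le_rfl ((F.Qf_mono _ (g := fun x => c * w x) h).trans fun x => ?_)
    exact (F.Qf_const_mul _ _ hw _).le

/-- Iterates `Model.moment_succ_le` on its off-diagonal term only; the diagonal term produced at
time `q` is kept as `coal` at `q`. -/
lemma Model.moment_le_sum [NeZero N] (n : ℕ) {f g : X → ℝ≥0∞} (hf : Measurable f)
    (hg : Measurable g) :
    F.moment μ N n f g ≤ (∫⁻ x, f x ∂(F.gamma μ n)) * (∫⁻ x, g x ∂(F.gamma μ n)) +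
      (N : ℝ≥0∞)⁻¹ * ∑ q ∈ Finset.range (n + 1),
        F.coal μ N q (fun x => F.sg q (n - q) f x * F.sg q (n - q) g x) := by
  induction n generalizing f g with
  | zero =>
    rw [F.lintegral_gamma_zero, F.lintegral_gamma_zero]
    simpa [Model.coal, Model.sg] using F.moment_zero_le μ (N := N) hf hg
  | succ n ih =>
    refine (F.moment_succ_le μ n hf hg).trans ?_
    refine (add_le_add_left (ih (F.measurable_Qf _ hf) (F.measurable_Qf _ hg)) _).trans
      (le_of_eq ?_)
    rw [F.lintegral_gamma_succ μ n hf, F.lintegral_gamma_succ μ n hg,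
      Finset.sum_range_succ _ (n + 1), mul_add, ← add_assoc]
    congr 1
    · congr 2
      refine Finset.sum_congr rfl fun q hq => ?_
      have hq' : q ≤ n := Nat.lt_succ_iff.1 (Finset.mem_range.1 hq)
      have h1 := F.sg_Qf q (n - q) f
      have h2 := F.sg_Qf q (n - q) g
      rw [show q + (n - q) + 1 = n + 1 by omega] at h1 h2
      rw [show n + 1 - q = n - q + 1 by omega, h1, h2]
    · simp [Model.coal, Model.sg]

end chain

lemma measurable_expV {V : X → ℝ} (hV : Measurable V) (β : ℝ) : Measurable (expV V β) := by
  unfold expV; fun_prop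

lemma measurableSet_sublevel {V : X → ℝ} (hV : Measurable V) (d : ℝ) :
    MeasurableSet (sublevel V d) := measurableSet_le hV measurable_const

/-! ### One-step consequences of drift, minorization and majorization. -/

namespace Model

variable {F : Model X} {V : X → ℝ} {δ dlow : ℝ} {b εm εp : ℝ → ℝ} {ν : ℝ → Measure X}
  {Gbar : ℝ}

lemma Drift.mono (h : F.Drift V δ dlow b) {δ' : ℝ} (h0 : 0 < δ') (hle : δ' ≤ δ) :
    F.Drift V δ' dlow b :=
  { h with
    delta_pos := h0
    drift := fun d hd n hn x => (h.drift d hd n hn x).trans <| by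
      have := h.one_le x
      exact ENNReal.ofReal_le_ofReal (Real.exp_le_exp.2 (by nlinarith)) }

lemma Drift.Qf_expV_one_le (h : F.Drift V δ dlow b) {n : ℕ} (hn : 1 ≤ n) (x : X) :
    F.Qf n (expV V 1) x ≤ ENNReal.ofReal (Real.exp |b dlow|) * expV V (1 - δ) x := by
  have h0 := h.drift dlow le_rfl n hn x
  simp only [Qf, expV, one_mul]
  rw [← ENNReal.ofReal_mul (Real.exp_pos _).le, ← Real.exp_add]
  refine h0.trans (ENNReal.ofReal_le_ofReal (Real.exp_le_exp.2 ?_))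
  have h1 := le_abs_self (b dlow)
  have h2 := abs_nonneg (b dlow)
  by_cases hx : x ∈ sublevel V dlow <;> simp [hx] <;> linarith

/-- Off `C_d` the gain `e^{-δV}` is at most `e^{-δd}`, so the contraction factor is as small as
desired, at the price of the additive constant on `C_d`. -/
lemma Drift.Qf_expV_one_le_add (h : F.Drift V δ dlow b) {d : ℝ} (hd : dlow ≤ d) {n : ℕ}
    (hn : 1 ≤ n) (x : X) :
    F.Qf n (expV V 1) x ≤ ENNReal.ofReal (Real.exp (-(δ * d))) * expV V 1 x +
      ENNReal.ofReal (Real.exp (d + b d)) * (sublevel V d).indicator 1 x := by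
  have h0 := h.drift d hd n hn x
  have hδ := h.delta_pos
  have hV := h.one_le x
  by_cases hx : x ∈ sublevel V d
  · have hx' : V x ≤ d := hx
    simp only [hx, Set.indicator_of_mem, mul_one, Pi.one_apply] at h0 ⊢
    simp only [Qf, expV, one_mul]
    exact (h0.trans (ENNReal.ofReal_le_ofReal (Real.exp_le_exp.2 (by nlinarith)))).trans
      le_add_self
  · have hx' : d < V x := not_le.1 hx
    simp only [hx, not_false_eq_true, Set.indicator_of_notMem, mul_zero, add_zero] at h0 ⊢
    simp only [Qf, expV, one_mul]
    rw [← ENNReal.ofReal_mul (Real.exp_pos _).le, ← Real.exp_add]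
    exact h0.trans (ENNReal.ofReal_le_ofReal (Real.exp_le_exp.2 (by nlinarith)))

/-- The drift condition is inherited by the powers `e^{βV}`, `β ≤ 1`. -/
lemma Drift.Qf_expV_le (h : F.Drift V δ dlow b) (hG : F.BoundedBy Gbar) {β : ℝ} (hβ0 : 0 ≤ β)
    (hβ : β ≤ 1)
    {n : ℕ} (hn : 1 ≤ n) (x : X) :
    F.Qf n (expV V β) x ≤
      (ENNReal.ofReal (Real.exp |b dlow|) + ENNReal.ofReal Gbar) * expV V (β * (1 - δ)) x := by
  -- Crossover level: `e^{βV(y)}` is at most `e^{βτ}` below it and at most `e^{-(1-β)τ} e^{V(y)}`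
  -- above it. Since `Q_n(e^V)(x)` is of order `e^τ` and `Q_n(1)` is bounded, both parts are of
  -- order `e^{βτ}`.
  set τ := (1 - δ) * V x
  have hpt : ∀ y, expV V β y ≤ ENNReal.ofReal (Real.exp (-(1 - β) * τ)) * expV V 1 y +
      expV V (β * (1 - δ)) x * (1 : X → ℝ≥0∞) y := by
    intro y
    simp only [expV, Pi.one_apply, mul_one]
    rw [← ENNReal.ofReal_mul (Real.exp_pos _).le, ← Real.exp_add]
    rcases le_total (V y) τ with hy | hy
    · refine (ENNReal.ofReal_le_ofReal (Real.exp_le_exp.2 ?_)).trans le_add_self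
      rw [mul_assoc]; exact mul_le_mul_of_nonneg_left hy hβ0
    · refine (ENNReal.ofReal_le_ofReal (Real.exp_le_exp.2 ?_)).trans le_self_add
      nlinarith
  calc F.Qf n (expV V β) x
      ≤ ∫⁻ y, (ENNReal.ofReal (Real.exp (-(1 - β) * τ)) * expV V 1 y +
        expV V (β * (1 - δ)) x * (1 : X → ℝ≥0∞) y) ∂(F.Q n x) := lintegral_mono hpt
    _ = ENNReal.ofReal (Real.exp (-(1 - β) * τ)) * F.Qf n (expV V 1) x +
        expV V (β * (1 - δ)) x * F.Qf n 1 x := by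
      rw [lintegral_add_right _ (measurable_one.const_mul _), lintegral_const_mul _
        (measurable_expV h.measurable _), lintegral_const_mul _ measurable_one]
      rfl
    _ ≤ ENNReal.ofReal (Real.exp (-(1 - β) * τ)) *
          (ENNReal.ofReal (Real.exp |b dlow|) * expV V (1 - δ) x) +
        expV V (β * (1 - δ)) x * ENNReal.ofReal Gbar := by
      gcongr
      · exact h.Qf_expV_one_le hn x
      · rw [F.Qf_one]; exact ENNReal.ofReal_le_ofReal (hG _ _)
    _ = _ := by
      have : ENNReal.ofReal (Real.exp (-(1 - β) * τ)) * expV V (1 - δ) x =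
          expV V (β * (1 - δ)) x := by
        rw [expV, expV, ← ENNReal.ofReal_mul (Real.exp_pos _).le, ← Real.exp_add]
        congr 2; simp only [τ]; ring
      rw [← this]; ring

/-- From a large sublevel set, the part of `Q_n(e^{βV})` carried by its complement is small with
respect to `e^{βV}`. -/
lemma Drift.setLIntegral_compl_expV_le (h : F.Drift V δ dlow b) (hδ : δ ≤ 1 / 2) {β : ℝ}
    (hβ : β ≤ 1 / 2) {d : ℝ} {n : ℕ} (hn : 1 ≤ n) {x : X}
    (hx : x ∈ sublevel V d) :
    ∫⁻ y in (sublevel V d)ᶜ, expV V β y ∂(F.Q n x) ≤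
      ENNReal.ofReal (Real.exp |b dlow|) * ENNReal.ofReal (Real.exp (-(β * δ * d))) *
        expV V β x := by
  have hx' : V x ≤ d := hx
  have hδ0 := h.delta_pos
  have hV := h.one_le x
  calc ∫⁻ y in (sublevel V d)ᶜ, expV V β y ∂(F.Q n x)
      ≤ ∫⁻ y in (sublevel V d)ᶜ, ENNReal.ofReal (Real.exp (-((1 - β) * d))) * expV V 1 y
          ∂(F.Q n x) := by
        refine setLIntegral_mono ((measurable_expV h.measurable 1).const_mul _) fun y hy => ?_
        have hy' : d < V y := not_le.1 hy
        rw [expV, expV, ← ENNReal.ofReal_mul (Real.exp_pos _).le, ← Real.exp_add]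
        exact ENNReal.ofReal_le_ofReal (Real.exp_le_exp.2 (by nlinarith))
    _ ≤ ∫⁻ y, ENNReal.ofReal (Real.exp (-((1 - β) * d))) * expV V 1 y ∂(F.Q n x) :=
        setLIntegral_le_lintegral _ _
    _ = ENNReal.ofReal (Real.exp (-((1 - β) * d))) * F.Qf n (expV V 1) x :=
        lintegral_const_mul _ (measurable_expV h.measurable 1)
    _ ≤ ENNReal.ofReal (Real.exp (-((1 - β) * d))) *
          (ENNReal.ofReal (Real.exp |b dlow|) * expV V (1 - δ) x) := by
        gcongr; exact h.Qf_expV_one_le hn x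
    _ = ENNReal.ofReal (Real.exp |b dlow|) *
          (ENNReal.ofReal (Real.exp (-((1 - β) * d))) * expV V (1 - δ) x) := by ring
    _ ≤ ENNReal.ofReal (Real.exp |b dlow|) *
          (ENNReal.ofReal (Real.exp (-(β * δ * d))) * expV V β x) := by
        refine mul_le_mul_right ?_ _
        rw [expV, expV, ← ENNReal.ofReal_mul (Real.exp_pos _).le, ← Real.exp_add,
          ← ENNReal.ofReal_mul (Real.exp_pos _).le, ← Real.exp_add]
        -- As `V x ≤ d` and `1 - δ - β ≥ 0`, the true gain is `e^{-δd}`; it is weakened to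
        -- `e^{-βδd}`, the rate available for `x` outside `C_d`.
        refine ENNReal.ofReal_le_ofReal (Real.exp_le_exp.2 ?_)
        have h1 : (1 - δ - β) * V x ≤ (1 - δ - β) * d :=
          mul_le_mul_of_nonneg_left hx' (by linarith)
        have h2 : β * (δ * d) ≤ 1 * (δ * d) :=
          mul_le_mul_of_nonneg_right (by linarith) (by nlinarith)
        nlinarith
    _ = _ := by ring

lemma Drift.Qf_expV_le_of_notMem (h : F.Drift V δ dlow b) (hG : F.BoundedBy Gbar) {β : ℝ}
    (hβ0 : 0 ≤ β) (hβ : β ≤ 1) {d : ℝ} {n : ℕ} (hn : 1 ≤ n) {x : X} (hx : x ∉ sublevel V d) :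
    F.Qf n (expV V β) x ≤ (ENNReal.ofReal (Real.exp |b dlow|) + ENNReal.ofReal Gbar) *
      ENNReal.ofReal (Real.exp (-(β * δ * d))) * expV V β x := by
  refine (h.Qf_expV_le hG hβ0 hβ hn x).trans ?_
  rw [mul_assoc]
  refine mul_le_mul_right ?_ _
  rw [expV, expV, ← ENNReal.ofReal_mul (Real.exp_pos _).le, ← Real.exp_add]
  refine ENNReal.ofReal_le_ofReal (Real.exp_le_exp.2 ?_)
  have hx' : d < V x := not_le.1 hx
  have := mul_le_mul_of_nonneg_left hx'.le (mul_nonneg hβ0 h.delta_pos.le)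
  nlinarith

lemma Minor.mul_setLIntegral_le (h : F.Minor V dlow εm ν) {d : ℝ}
    (hd : dlow ≤ d) {n : ℕ} (hn : 1 ≤ n) {x : X} (hx : x ∈ sublevel V d) (u : X → ℝ≥0∞) :
    ENNReal.ofReal (εm d) * ∫⁻ y in sublevel V d, u y ∂(ν d) ≤
      ∫⁻ y in sublevel V d, u y ∂(F.Q n x) := by
  rw [← smul_eq_mul, ← lintegral_smul_measure]
  refine lintegral_mono' (Measure.le_iff.2 fun A hA => ?_) le_rfl
  rw [Measure.smul_apply, Measure.restrict_apply hA, Measure.restrict_apply hA, Set.inter_comm]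
  exact h.minor d hd n hn x hx A hA

lemma Major.setLIntegral_le (h : F.Major V dlow εm εp ν) {d : ℝ}
    (hd : dlow ≤ d) {n : ℕ} (hn : 1 ≤ n) {x : X} (hx : x ∈ sublevel V d) (u : X → ℝ≥0∞) :
    ∫⁻ y in sublevel V d, u y ∂(F.Q n x) ≤
      ENNReal.ofReal (εp d) * ∫⁻ y in sublevel V d, u y ∂(ν d) := by
  rw [← smul_eq_mul, ← lintegral_smul_measure]
  refine lintegral_mono' (Measure.le_iff.2 fun A hA => ?_) le_rfl
  rw [Measure.smul_apply, Measure.restrict_apply hA, Measure.restrict_apply hA, Set.inter_comm]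
  exact h.major d hd n hn x hx A hA

/-- The minorizing constant does not depend on the starting point in `C_d`, so integrating it
against `γ_n` produces the mass of `C_d`. -/
lemma Minor.mul_gamma_le (h : F.Minor V dlow εm ν) (μ : Measure X) {d : ℝ}
    (hd : dlow ≤ d) (n : ℕ) {u : X → ℝ≥0∞} (hu : Measurable u) :
    (ENNReal.ofReal (εm d) * ∫⁻ y in sublevel V d, u y ∂(ν d)) * F.gamma μ n (sublevel V d) ≤
      ∫⁻ x, u x ∂(F.gamma μ (n + 1)) := by
  rw [F.lintegral_gamma_succ μ n hu, ← setLIntegral_const]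
  calc _ ≤ ∫⁻ x in sublevel V d, F.Qf (n + 1) u x ∂(F.gamma μ n) := by
        refine setLIntegral_mono (F.measurable_Qf _ hu) fun x hx => ?_
        exact (h.mul_setLIntegral_le hd n.succ_pos hx u).trans (setLIntegral_le_lintegral _ _)
    _ ≤ _ := setLIntegral_le_lintegral _ _

lemma Minor.mul_gamma_sublevel_le (h : F.Minor V dlow εm ν) (hV : Measurable V) (μ : Measure X)
    {r d : ℝ} (hr : dlow ≤ r) (hd : r ≤ d) (n : ℕ) :
    (ENNReal.ofReal (εm d) * ν d (sublevel V r)) * F.gamma μ n (sublevel V d) ≤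
      F.gamma μ (n + 1) (sublevel V r) := by
  have hm := measurableSet_sublevel hV r
  have h1 := h.mul_gamma_le μ (hr.trans hd) n (u := (sublevel V r).indicator 1)
    (measurable_one.indicator hm)
  rw [lintegral_indicator_one hm, lintegral_indicator_one hm, Measure.restrict_apply hm,
    Set.inter_eq_left.2 (sublevel_mono V hd)] at h1
  exact h1

/-! ### Tightness of the flow and stability of the semigroup, uniformly over models. -/

/-- Uniform tightness of the flow: the mass that `γ_p` gives to `v` is controlled by the mass of a
fixed sublevel set, which is itself propagated at a fixed rate. -/
lemma exists_gamma_tight (μ : Measure X) [IsProbabilityMeasure μ] (hD : F.Drift V δ dlow b)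
    (hμ : MemPv V μ) (hm : F.Minor V dlow εm ν) :
    ∃ (r : ℝ) (a T : ℝ≥0∞), dlow ≤ r ∧ a ≠ 0 ∧ a ≠ ∞ ∧ T ≠ ∞ ∧ μ (sublevel V r) ≠ 0 ∧
      ∀ F' : Model X, F'.Drift V δ dlow b → F'.Minor V dlow εm ν → ∀ p,
        ∫⁻ x, expV V 1 x ∂(F'.gamma μ p) ≤ T * F'.gamma μ p (sublevel V r) ∧
        a * F'.gamma μ p (sublevel V r) ≤ F'.gamma μ (p + 1) (sublevel V r) := by
  have hV := hD.measurable
  obtain ⟨r, hr, hr0⟩ : ∃ r, dlow ≤ r ∧ μ (sublevel V r) ≠ 0 := by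
    by_contra hcon
    push Not at hcon
    have h0 : μ (⋃ n : ℕ, sublevel V (max dlow n)) = 0 :=
      measure_iUnion_null fun n => hcon _ (le_max_left _ _)
    have h1 : (⋃ n : ℕ, sublevel V (max dlow n)) = Set.univ := by
      refine Set.eq_univ_of_forall fun x => ?_
      obtain ⟨n, hn⟩ := exists_nat_ge (V x)
      exact Set.mem_iUnion.2 ⟨n, hn.trans (le_max_right _ _)⟩
    rw [h1] at h0
    simp at h0
  have hpos : ∀ d, r ≤ d → ENNReal.ofReal (εm d) * ν d (sublevel V r) ≠ 0 := fun d hd =>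
    mul_ne_zero (by simpa using hm.eps_pos d (hr.trans hd))
      (hm.charge d (hr.trans hd) r ⟨hr, hd⟩).ne'
  have hfin : ∀ d, dlow ≤ d → ENNReal.ofReal (εm d) * ν d (sublevel V r) ≠ ∞ := fun d hd => by
    have := (hm.mem_Pv d hd).1
    exact ENNReal.mul_ne_top ENNReal.ofReal_ne_top (measure_ne_top _ _)
  set a := ENNReal.ofReal (εm r) * ν r (sublevel V r) with ha
  -- `d` is so large that twice the contraction factor is below the propagation rate `a` of `C_r`.
  obtain ⟨d, hd, hκ⟩ := exists_ofReal_exp_neg_mul_le hD.delta_pos (K := 2) (by simp)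
    (hpos r le_rfl) r
  set κ := ENNReal.ofReal (Real.exp (-(δ * d)))
  set K := ENNReal.ofReal (Real.exp (d + b d))
  set a' := ENNReal.ofReal (εm d) * ν d (sublevel V r) with ha'
  have hμv : ∫⁻ x, expV V 1 x ∂μ ≠ ∞ := by
    have := hμ.2.ne
    simpa [expV] using this
  -- The first summand closes the induction step (`2K ≤ T a'`), the second is the initial case.
  set T := 2 * K / a' + (∫⁻ x, expV V 1 x ∂μ) / μ (sublevel V r) with hT
  have hTa : 2 * K ≤ T * a' := by
    calc 2 * K = 2 * K / a' * a' :=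
          (ENNReal.div_mul_cancel (hpos d hd) (hfin d (hr.trans hd))).symm
      _ ≤ T * a' := mul_le_mul_left le_self_add _
  have hTμ : ∫⁻ x, expV V 1 x ∂μ ≤ T * μ (sublevel V r) := by
    calc ∫⁻ x, expV V 1 x ∂μ = (∫⁻ x, expV V 1 x ∂μ) / μ (sublevel V r) * μ (sublevel V r) :=
          (ENNReal.div_mul_cancel hr0 (measure_ne_top _ _)).symm
      _ ≤ _ := mul_le_mul_left le_add_self _
  refine ⟨r, a, T, hr, hpos r le_rfl, hfin r hr, ?_, hr0, fun F' hD' hm' p => ?_⟩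
  · exact ENNReal.add_ne_top.2
      ⟨ENNReal.div_ne_top (ENNReal.mul_ne_top (by simp) ENNReal.ofReal_ne_top) (hpos d hd),
        ENNReal.div_ne_top hμv hr0⟩
  have hrate : ∀ p, a * F'.gamma μ p (sublevel V r) ≤ F'.gamma μ (p + 1) (sublevel V r) :=
    fun p => hm'.mul_gamma_sublevel_le hV μ hr le_rfl p
  refine ⟨?_, hrate p⟩
  induction p with
  | zero =>
    rw [F'.lintegral_gamma_zero]
    have : F'.gamma μ 0 = μ := by simp [Model.gamma, Model.Q₀]
    rw [this]; exact hTμ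
  | succ p ih =>
    have hmd := measurableSet_sublevel hV d
    have h1 : ∫⁻ x, expV V 1 x ∂(F'.gamma μ (p + 1)) ≤
        κ * (∫⁻ x, expV V 1 x ∂(F'.gamma μ p)) + K * F'.gamma μ p (sublevel V d) := by
      rw [F'.lintegral_gamma_succ μ p (measurable_expV hV 1)]
      refine (lintegral_mono fun x =>
        hD'.Qf_expV_one_le_add (hr.trans hd) p.succ_pos x).trans_eq ?_
      rw [lintegral_add_left ((measurable_expV hV 1).const_mul _),
        lintegral_const_mul _ (measurable_expV hV 1),
        lintegral_const_mul _ (measurable_one.indicator hmd), lintegral_indicator_one hmd]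
    -- `γ_{p+1}(C_r)` is bounded below both through `C_r` (rate `a`) and through `C_d` (rate `a'`);
    -- one copy absorbs the contracted part, the other the additive part.
    have h2 : 2 * ∫⁻ x, expV V 1 x ∂(F'.gamma μ (p + 1)) ≤
        2 * (T * F'.gamma μ (p + 1) (sublevel V r)) := by
      calc _ ≤ 2 * (κ * (T * F'.gamma μ p (sublevel V r)) + K * F'.gamma μ p (sublevel V d)) := by
            gcongr; exact h1.trans (by gcongr)
        _ = (2 * κ) * (T * F'.gamma μ p (sublevel V r)) + (2 * K) * F'.gamma μ p (sublevel V d) :=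
            by ring
        _ ≤ a * (T * F'.gamma μ p (sublevel V r)) + (T * a') * F'.gamma μ p (sublevel V d) := by
            gcongr
        _ = T * (a * F'.gamma μ p (sublevel V r)) + T * (a' * F'.gamma μ p (sublevel V d)) := by
            ring
        _ ≤ T * F'.gamma μ (p + 1) (sublevel V r) + T * F'.gamma μ (p + 1) (sublevel V r) := by
            gcongr
            · exact hrate p
            · exact hm'.mul_gamma_sublevel_le hV μ hr hd p
        _ = _ := by ring
    exact (ENNReal.mul_le_mul_iff_right (by simp) (by simp)).1 h2

/-- Stability of the semigroup: `Q_{j,j+k}(e^{βV})` is controlled by `e^{βV}`, uniformly in time,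
after normalization along the flow. -/
lemma exists_sg_expV_le (μ : Measure X) [IsProbabilityMeasure μ] (hD : F.Drift V δ dlow b)
    (hm : F.Minor V dlow εm ν) (hδ : δ ≤ 1 / 2) {β : ℝ} (hβ0 : 0 < β) (hβ : β ≤ 1 / 2)
    {r : ℝ} {a T : ℝ≥0∞} (hr : dlow ≤ r) (ha0 : a ≠ 0) (ha : a ≠ ∞) (hT : T ≠ ∞) :
    ∃ E : ℝ≥0∞, E ≠ ∞ ∧ ∀ F' : Model X, F'.Drift V δ dlow b → F'.Minor V dlow εm ν →
      F'.Major V dlow εm εp ν → F'.BoundedBy Gbar →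
      (∀ p, ∫⁻ x, expV V 1 x ∂(F'.gamma μ p) ≤ T * F'.gamma μ p (sublevel V r)) →
      (∀ p, a * F'.gamma μ p Set.univ ≤ T * F'.gamma μ (p + 1) Set.univ) →
      ∀ k j x, F'.gamma μ j Set.univ * F'.sg j k (expV V β) x ≤
        E * expV V β x * ∫⁻ y, expV V β y ∂(F'.gamma μ (j + k)) := by
  have hV := hD.measurable
  have hw := measurable_expV hV β
  set K := ENNReal.ofReal (Real.exp |b dlow|) + ENNReal.ofReal Gbar with hK
  -- The gain `e^{-βδd}` must beat `T / a`, the largest loss of mass of the flow in one step, with a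
  -- factor 2 to spare.
  obtain ⟨d, hd, hκ⟩ := exists_ofReal_exp_neg_mul_le (mul_pos hβ0 hD.delta_pos)
    (K := 2 * T * K) (t := a) (ENNReal.mul_ne_top (ENNReal.mul_ne_top (by simp) hT)
      (ENNReal.add_ne_top.2 ⟨ENNReal.ofReal_ne_top, ENNReal.ofReal_ne_top⟩)) ha0 r
  have hdl := hr.trans hd
  set κ := K * ENNReal.ofReal (Real.exp (-(β * δ * d))) with hκdef
  have hκ' : 2 * T * κ ≤ a := by rw [hκdef, ← mul_assoc]; exact hκ
  set ε := ENNReal.ofReal (εm d) with hε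
  have hε0 : ε ≠ 0 := by simpa [hε] using hm.eps_pos d hdl
  have hεt : ε ≠ ∞ := ENNReal.ofReal_ne_top
  set ε' := ENNReal.ofReal (εp d) with hε'
  -- The `1` serves `k = 0`; the other term is the cost of comparing with the flow on `C_d`, the
  -- same for every `k`.
  refine ⟨1 + 2 * (ε' * T / ε), ENNReal.add_ne_top.2 ⟨by simp, ENNReal.mul_ne_top (by simp)
    (ENNReal.div_ne_top (ENNReal.mul_ne_top ENNReal.ofReal_ne_top hT) hε0)⟩,
    fun F' hD' hm' hM' hG' htight hrate k => ?_⟩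
  set E := 1 + 2 * (ε' * T / ε) with hE
  have hE1 : 1 ≤ E := le_self_add
  have hE2 : 2 * (ε' * T / ε) ≤ E := le_add_self
  have hw1 : ∀ x, 1 ≤ expV V β x := one_le_expV hD.one_le hβ0.le
  induction k with
  | zero =>
    intro j x
    have h1 : F'.gamma μ j Set.univ ≤ ∫⁻ y, expV V β y ∂(F'.gamma μ j) := by
      rw [← lintegral_one]; exact lintegral_mono hw1
    change F'.gamma μ j Set.univ * expV V β x ≤ _
    calc F'.gamma μ j Set.univ * expV V β x = 1 * expV V β x * F'.gamma μ j Set.univ := by ring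
      _ ≤ _ := by gcongr; exact h1
  | succ k ih =>
    intro j x
    set u := F'.sg (j + 1) k (expV V β) with hu
    have hum : Measurable u := F'.measurable_sg _ _ hw
    set Γ := ∫⁻ y, expV V β y ∂(F'.gamma μ (j + (k + 1))) with hΓ
    have ih' : ∀ y, F'.gamma μ (j + 1) Set.univ * u y ≤ E * expV V β y * Γ := by
      intro y
      have := ih (j + 1) y
      rwa [show j + 1 + k = j + (k + 1) by ring] at this
    -- Wherever the drift gains `κ`, the induction hypothesis at time `j + 1` yields half of the
    -- target with the same `E`.
    have hfar : ∀ S : Set X, ∫⁻ y in S, expV V β y ∂(F'.Q (j + 1) x) ≤ κ * expV V β x →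
        2 * (F'.gamma μ j Set.univ * ∫⁻ y in S, u y ∂(F'.Q (j + 1) x)) ≤
          E * expV V β x * Γ := by
      intro S hS
      refine (ENNReal.mul_le_mul_iff_right ha0 ha).1 ?_
      calc a * (2 * (F'.gamma μ j Set.univ * ∫⁻ y in S, u y ∂(F'.Q (j + 1) x)))
          = 2 * (a * F'.gamma μ j Set.univ) * ∫⁻ y in S, u y ∂(F'.Q (j + 1) x) := by ring
        _ ≤ 2 * (T * F'.gamma μ (j + 1) Set.univ) * ∫⁻ y in S, u y ∂(F'.Q (j + 1) x) := by
            exact mul_le_mul_left (mul_le_mul_right (hrate j) _) _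
        _ = 2 * T * ∫⁻ y in S, F'.gamma μ (j + 1) Set.univ * u y ∂(F'.Q (j + 1) x) := by
            rw [lintegral_const_mul _ hum]; ring
        _ ≤ 2 * T * ∫⁻ y in S, (E * Γ) * expV V β y ∂(F'.Q (j + 1) x) := by
            refine mul_le_mul_right (lintegral_mono fun y => ?_) _
            exact (ih' y).trans_eq (by ring)
        _ = 2 * T * ((E * Γ) * ∫⁻ y in S, expV V β y ∂(F'.Q (j + 1) x)) := by
            rw [lintegral_const_mul _ hw]
        _ ≤ 2 * T * ((E * Γ) * (κ * expV V β x)) := by gcongr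
        _ = (2 * T * κ) * (E * expV V β x * Γ) := by ring
        _ ≤ _ := by gcongr
    change F'.gamma μ j Set.univ * F'.Qf (j + 1) u x ≤ E * expV V β x * Γ
    by_cases hx : x ∈ sublevel V d
    -- No induction here: majorization replaces `Q_{j+1}(x, ·)` on `C_d` by `ν_d`, minorization
    -- bounds the `ν_d` integral by the flow, and tightness restores the full mass of `γ_j`.
    · have hnear : 2 * (F'.gamma μ j Set.univ * ∫⁻ y in sublevel V d, u y ∂(F'.Q (j + 1) x)) ≤
          E * expV V β x * Γ := by
        have hΓ' : (ε * ∫⁻ y in sublevel V d, u y ∂(ν d)) * F'.gamma μ j (sublevel V d) ≤ Γ := by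
          refine (hm'.mul_gamma_le μ hdl j hum).trans_eq ?_
          rw [F'.lintegral_gamma_sg μ _ _ hw, show j + 1 + k = j + (k + 1) by ring]
        have hmass : F'.gamma μ j Set.univ ≤ T * F'.gamma μ j (sublevel V d) := by
          calc F'.gamma μ j Set.univ ≤ ∫⁻ y, expV V 1 y ∂(F'.gamma μ j) := by
                rw [← lintegral_one]
                exact lintegral_mono (one_le_expV hD.one_le zero_le_one)
            _ ≤ T * F'.gamma μ j (sublevel V r) := htight j
            _ ≤ _ := by gcongr; exact sublevel_mono V hd
        refine (ENNReal.mul_le_mul_iff_right hε0 hεt).1 ?_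
        calc ε * (2 * (F'.gamma μ j Set.univ * ∫⁻ y in sublevel V d, u y ∂(F'.Q (j + 1) x)))
            ≤ ε * (2 * ((T * F'.gamma μ j (sublevel V d)) *
                (ε' * ∫⁻ y in sublevel V d, u y ∂(ν d)))) := by
              gcongr
              exact hM'.setLIntegral_le hdl j.succ_pos hx u
          _ = 2 * (ε' * T) * ((ε * ∫⁻ y in sublevel V d, u y ∂(ν d)) *
                F'.gamma μ j (sublevel V d)) := by ring
          _ ≤ 2 * (ε' * T) * Γ := by gcongr
          _ = 2 * (ε' * T / ε * ε) * Γ := by rw [ENNReal.div_mul_cancel hε0 hεt]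
          _ = ε * ((2 * (ε' * T / ε)) * 1 * Γ) := by ring
          _ ≤ ε * (E * expV V β x * Γ) := by
              gcongr
              exact hw1 x
      have hout := hfar (sublevel V d)ᶜ <| by
        refine (hD'.setLIntegral_compl_expV_le hδ hβ j.succ_pos hx).trans ?_
        exact mul_le_mul_left (mul_le_mul_left le_self_add _) _
      refine (ENNReal.mul_le_mul_iff_right (a := 2) (by simp) (by simp)).1 ?_
      calc 2 * (F'.gamma μ j Set.univ * F'.Qf (j + 1) u x)
          = 2 * (F'.gamma μ j Set.univ * ∫⁻ y in sublevel V d, u y ∂(F'.Q (j + 1) x)) +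
            2 * (F'.gamma μ j Set.univ * ∫⁻ y in (sublevel V d)ᶜ, u y ∂(F'.Q (j + 1) x)) := by
            rw [Qf, ← lintegral_add_compl u (measurableSet_sublevel hV d)]; ring
        _ ≤ E * expV V β x * Γ + E * expV V β x * Γ := add_le_add hnear hout
        _ = _ := by ring
    · have h1 := hfar Set.univ <| by
        rw [Measure.restrict_univ]
        exact hD'.Qf_expV_le_of_notMem hG' hβ0.le (by linarith) j.succ_pos hx
      rw [Measure.restrict_univ] at h1
      refine le_trans ?_ h1
      rw [two_mul]; exact le_self_add

lemma gamma_zero (F : Model X) (μ : Measure X) : F.gamma μ 0 = μ := by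
  simp [Model.gamma, Model.Q₀]

lemma BoundedBy.gamma_univ_ne_top {F : Model X} {Gbar : ℝ} (hG : F.BoundedBy Gbar)
    (μ : Measure X) [IsProbabilityMeasure μ] (n : ℕ) : F.gamma μ n Set.univ ≠ ∞ := by
  induction n with
  | zero => rw [gamma_zero]; simp
  | succ n ih =>
    rw [← lintegral_one, ← Pi.one_def, F.lintegral_gamma_succ μ n measurable_one]
    refine ne_top_of_le_ne_top (ENNReal.mul_ne_top (ENNReal.ofReal_ne_top (r := Gbar)) ih) ?_
    rw [← lintegral_const]
    refine lintegral_mono fun x => ?_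
    rw [F.Qf_one]
    exact ENNReal.ofReal_le_ofReal (hG _ _)

/-- Uniform bounds for the second-moment expansion: the diagonal products of the semigroup are
controlled by `w = e^{V/2}`, uniformly in time, after normalization along the flow. -/
lemma exists_sg_mul_sg_le {F : Model X} {V : X → ℝ} {δ dlow : ℝ} {b εm εp : ℝ → ℝ}
    {ν : ℝ → Measure X} {Gbar : ℝ} (μ : Measure X) [IsProbabilityMeasure μ]
    (hD : F.Drift V δ dlow b) (hμ : MemPv V μ) (hm : F.Minor V dlow εm ν) :
    ∃ C T : ℝ≥0∞, C ≠ ∞ ∧ T ≠ ∞ ∧ ∀ F' : Model X, F'.Drift V δ dlow b →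
      F'.Minor V dlow εm ν → F'.Major V dlow εm εp ν → F'.BoundedBy Gbar →
      (∀ p, F'.gamma μ p Set.univ ≠ 0) ∧
      (∀ p, ∫⁻ x, expV V (1 / 2) x ∂(F'.gamma μ p) ≤ T * F'.gamma μ p Set.univ) ∧
      (∀ q k x, F'.gamma μ q Set.univ ^ 2 * (F'.sg q k 1 x * F'.sg q k 1 x) ≤
        C * F'.gamma μ (q + k) Set.univ ^ 2 * expV V (1 / 2) x) ∧
      (∀ q k x, F'.gamma μ q Set.univ ^ 2 *
          (F'.sg q (k + 1) 1 x * F'.sg q (k + 1) (expV V (1 / 2)) x) ≤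
        C * F'.gamma μ (q + (k + 1)) Set.univ ^ 2 * expV V (1 / 2) x) := by
  have hV := hD.measurable
  have hV1 := hD.one_le
  obtain ⟨r, a, T, hr, ha0, ha, hT, hr0, htight⟩ := exists_gamma_tight μ hD hμ hm
  set δ' := min δ (1 / 2) with hδ'
  have hδ0 : 0 < δ' := lt_min hD.delta_pos (by norm_num)
  have hδ1 : δ' ≤ 1 / 2 := min_le_right _ _
  have hD₀ := hD.mono hδ0 (min_le_left _ _)
  -- The exponent `δ'/2` is exactly what one drift step removes from `1/2`, so the product of the
  -- two bounds has exponent `1/2` again.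
  obtain ⟨E₁, hE₁, hsg₁⟩ := exists_sg_expV_le (εp := εp) (Gbar := Gbar) μ hD₀ hm hδ1
    (β := δ' / 2) (by positivity) (by linarith) hr ha0 ha hT
  obtain ⟨E₂, hE₂, hsg₂⟩ := exists_sg_expV_le (εp := εp) (Gbar := Gbar) μ hD₀ hm hδ1
    (β := 1 / 2) (by norm_num) le_rfl hr ha0 ha hT
  set K := ENNReal.ofReal (Real.exp |b dlow|) + ENNReal.ofReal Gbar
  have hK : K ≠ ∞ := ENNReal.add_ne_top.2 ⟨ENNReal.ofReal_ne_top, ENNReal.ofReal_ne_top⟩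
  set C₁ := E₁ * T with hC₁
  set C₂ := E₂ * T * (T / a) * K with hC₂
  have hC₁t : C₁ ≠ ∞ := ENNReal.mul_ne_top hE₁ hT
  have hC₂t : C₂ ≠ ∞ := ENNReal.mul_ne_top (ENNReal.mul_ne_top (ENNReal.mul_ne_top hE₂ hT)
    (ENNReal.div_ne_top hT ha0)) hK
  refine ⟨C₁ * C₁ + C₁ * C₂, T, ENNReal.add_ne_top.2 ⟨ENNReal.mul_ne_top hC₁t hC₁t,
    ENNReal.mul_ne_top hC₁t hC₂t⟩, hT, fun F' hD' hm' hM' hG' => ?_⟩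
  have hD'' := hD'.mono hδ0 (min_le_left _ _)
  have ht := fun p => (htight F' hD' hm' p).1
  have hstep := fun p => (htight F' hD' hm' p).2
  have hv : ∀ {β : ℝ}, β ≤ 1 → ∀ p,
      ∫⁻ x, expV V β x ∂(F'.gamma μ p) ≤ T * F'.gamma μ p Set.univ := fun hβ p =>
    (lintegral_mono (expV_mono hV1 hβ)).trans
      ((ht p).trans (mul_le_mul_right (measure_mono (Set.subset_univ _)) _))
  have hrate : ∀ p, a * F'.gamma μ p Set.univ ≤ T * F'.gamma μ (p + 1) Set.univ := fun p => by
    calc a * F'.gamma μ p Set.univ ≤ a * ∫⁻ x, expV V 1 x ∂(F'.gamma μ p) := by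
          rw [← lintegral_one]
          exact mul_le_mul_right (lintegral_mono (one_le_expV hV1 zero_le_one)) _
      _ ≤ a * (T * F'.gamma μ p (sublevel V r)) := mul_le_mul_right (ht p) _
      _ = T * (a * F'.gamma μ p (sublevel V r)) := by ring
      _ ≤ T * F'.gamma μ (p + 1) (sublevel V r) := mul_le_mul_right (hstep p) _
      _ ≤ _ := mul_le_mul_right (measure_mono (Set.subset_univ _)) _
  have hpos : ∀ p, F'.gamma μ p (sublevel V r) ≠ 0 := by
    intro p
    induction p with
    | zero => rwa [gamma_zero]
    | succ p ih =>
      exact ((pos_iff_ne_zero.2 (mul_ne_zero ha0 ih)).trans_le (hstep p)).ne'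
  have h1 : ∀ q k x, F'.gamma μ q Set.univ * F'.sg q k 1 x ≤
      C₁ * F'.gamma μ (q + k) Set.univ * expV V (δ' / 2) x := by
    intro q k x
    calc F'.gamma μ q Set.univ * F'.sg q k 1 x
        ≤ F'.gamma μ q Set.univ * F'.sg q k (expV V (δ' / 2)) x :=
          mul_le_mul_right (F'.sg_mono q k (one_le_expV hV1 (by positivity)) x) _
      _ ≤ E₁ * expV V (δ' / 2) x * ∫⁻ y, expV V (δ' / 2) y ∂(F'.gamma μ (q + k)) :=
          hsg₁ F' hD'' hm' hM' hG' ht hrate k q x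
      _ ≤ E₁ * expV V (δ' / 2) x * (T * F'.gamma μ (q + k) Set.univ) :=
          mul_le_mul_right (hv (by linarith) _) _
      _ = _ := by rw [hC₁]; ring
  have h2 : ∀ q k x, F'.gamma μ q Set.univ * F'.sg q (k + 1) (expV V (1 / 2)) x ≤
      C₂ * F'.gamma μ (q + (k + 1)) Set.univ * expV V (1 / 2 * (1 - δ')) x := by
    intro q k x
    -- Stability handles the last `k` steps; the first is set aside so that the drift lowers the
    -- exponent to `(1 - δ')/2`. Hence at least one step is needed.
    set u := F'.sg (q + 1) k (expV V (1 / 2)) with hu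
    have hum : Measurable u := F'.measurable_sg _ _ (measurable_expV hV _)
    have hγ : F'.gamma μ q Set.univ ≤ T / a * F'.gamma μ (q + 1) Set.univ := by
      rw [ENNReal.div_eq_inv_mul, mul_assoc]
      calc F'.gamma μ q Set.univ = a⁻¹ * (a * F'.gamma μ q Set.univ) := by
            rw [← mul_assoc, ENNReal.inv_mul_cancel ha0 ha, one_mul]
        _ ≤ _ := mul_le_mul_right (hrate q) _
    have hub : ∀ y, F'.gamma μ (q + 1) Set.univ * u y ≤
        E₂ * (T * F'.gamma μ (q + (k + 1)) Set.univ) * expV V (1 / 2) y := by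
      intro y
      refine (hsg₂ F' hD'' hm' hM' hG' ht hrate k (q + 1) y).trans ?_
      rw [show q + 1 + k = q + (k + 1) by ring]
      refine (mul_le_mul_right (hv (by norm_num) _) _).trans_eq ?_
      ring
    change F'.gamma μ q Set.univ * F'.Qf (q + 1) u x ≤ _
    calc F'.gamma μ q Set.univ * F'.Qf (q + 1) u x
        ≤ T / a * F'.gamma μ (q + 1) Set.univ * F'.Qf (q + 1) u x := mul_le_mul_left hγ _
      _ = T / a * F'.Qf (q + 1) (fun y => F'.gamma μ (q + 1) Set.univ * u y) x := by
          rw [F'.Qf_const_mul _ _ hum, mul_assoc]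
      _ ≤ T / a * F'.Qf (q + 1) (fun y => E₂ * (T * F'.gamma μ (q + (k + 1)) Set.univ) *
            expV V (1 / 2) y) x := mul_le_mul_right (F'.Qf_mono _ hub x) _
      _ = T / a * (E₂ * (T * F'.gamma μ (q + (k + 1)) Set.univ) *
            F'.Qf (q + 1) (expV V (1 / 2)) x) := by
          rw [F'.Qf_const_mul _ _ (measurable_expV hV _)]
      _ ≤ T / a * (E₂ * (T * F'.gamma μ (q + (k + 1)) Set.univ) *
            (K * expV V (1 / 2 * (1 - δ')) x)) := by
          refine mul_le_mul_right (mul_le_mul_right ?_ _) _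
          exact hD''.Qf_expV_le hG' (by norm_num) (by norm_num) q.succ_pos x
      _ = _ := by rw [hC₂]; ring
  refine ⟨fun p h0 => hpos p (measure_mono_null (Set.subset_univ _) h0), hv (by norm_num),
    fun q k x => ?_, fun q k x => ?_⟩
  · calc F'.gamma μ q Set.univ ^ 2 * (F'.sg q k 1 x * F'.sg q k 1 x)
        = (F'.gamma μ q Set.univ * F'.sg q k 1 x) * (F'.gamma μ q Set.univ * F'.sg q k 1 x) := by
          ring
      _ ≤ (C₁ * F'.gamma μ (q + k) Set.univ * expV V (δ' / 2) x) *
          (C₁ * F'.gamma μ (q + k) Set.univ * expV V (δ' / 2) x) :=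
          mul_le_mul' (h1 q k x) (h1 q k x)
      _ = C₁ * C₁ * F'.gamma μ (q + k) Set.univ ^ 2 *
          (expV V (δ' / 2) x * expV V (δ' / 2) x) := by ring
      _ ≤ _ := by
          rw [expV_mul]
          exact mul_le_mul' (mul_le_mul_left le_self_add _) (expV_mono hV1 (by linarith) x)
  · calc F'.gamma μ q Set.univ ^ 2 *
          (F'.sg q (k + 1) 1 x * F'.sg q (k + 1) (expV V (1 / 2)) x)
        = (F'.gamma μ q Set.univ * F'.sg q (k + 1) 1 x) *
          (F'.gamma μ q Set.univ * F'.sg q (k + 1) (expV V (1 / 2)) x) := by ring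
      _ ≤ (C₁ * F'.gamma μ (q + (k + 1)) Set.univ * expV V (δ' / 2) x) *
          (C₂ * F'.gamma μ (q + (k + 1)) Set.univ * expV V (1 / 2 * (1 - δ')) x) :=
          mul_le_mul' (h1 q (k + 1) x) (h2 q k x)
      _ = C₁ * C₂ * F'.gamma μ (q + (k + 1)) Set.univ ^ 2 *
          (expV V (δ' / 2) x * expV V (1 / 2 * (1 - δ')) x) := by ring
      _ ≤ _ := by
          rw [expV_mul]
          exact mul_le_mul' (mul_le_mul_left le_add_self _) (expV_mono hV1 (by linarith) x)

/-! ### Closing the second-moment estimate. -/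

/-- Linear growth of the relative second moment of `γ_n^N(1)`, from the control of the diagonal
products of the semigroup by a function `w`. -/
lemma moment_one_le (F : Model X) (μ : Measure X) [IsProbabilityMeasure μ] {w : X → ℝ≥0∞}
    (hw : Measurable w) {C T : ℝ≥0∞} (h0 : ∀ p, F.gamma μ p Set.univ ≠ 0)
    (ht : ∀ p, F.gamma μ p Set.univ ≠ ∞)
    (hT : ∀ p, ∫⁻ x, w x ∂(F.gamma μ p) ≤ T * F.gamma μ p Set.univ)
    (h1 : ∀ q k x, F.gamma μ q Set.univ ^ 2 * (F.sg q k 1 x * F.sg q k 1 x) ≤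
      C * F.gamma μ (q + k) Set.univ ^ 2 * w x)
    (h2 : ∀ q k x, F.gamma μ q Set.univ ^ 2 * (F.sg q (k + 1) 1 x * F.sg q (k + 1) w x) ≤
      C * F.gamma μ (q + (k + 1)) Set.univ ^ 2 * w x)
    (N : ℕ) [NeZero N] (n : ℕ) (hN : (N : ℝ≥0∞)⁻¹ * (n + 1 : ℕ) * (2 * C) ≤ 1) :
    F.moment μ N n 1 1 ≤ F.gamma μ n Set.univ ^ 2 +
      (N : ℝ≥0∞)⁻¹ * (n + 1 : ℕ) * (C * (2 * T)) * F.gamma μ n Set.univ ^ 2 := by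
  -- Any coalescence term is reduced to the one for `w`, by homogeneity and monotonicity in `u`.
  have hcoal : ∀ q m (u : X → ℝ≥0∞),
      (∀ x, F.gamma μ q Set.univ ^ 2 * u x ≤ C * F.gamma μ m Set.univ ^ 2 * w x) →
      F.coal μ N q w ≤ 2 * T * F.gamma μ q Set.univ ^ 2 →
      F.coal μ N q u ≤ C * (2 * T) * F.gamma μ m Set.univ ^ 2 := by
    intro q m u hu hq
    have h0' : F.gamma μ q Set.univ ^ 2 ≠ 0 := pow_ne_zero _ (h0 q)
    have ht' : F.gamma μ q Set.univ ^ 2 ≠ ∞ := ENNReal.pow_ne_top (ht q)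
    have hle := F.coal_le_mul μ (N := N) q
      ((F.gamma μ q Set.univ ^ 2)⁻¹ * (C * F.gamma μ m Set.univ ^ 2)) (u := u) hw fun x => by
        calc u x = (F.gamma μ q Set.univ ^ 2)⁻¹ * (F.gamma μ q Set.univ ^ 2 * u x) := by
              rw [← mul_assoc, ENNReal.inv_mul_cancel h0' ht', one_mul]
          _ ≤ _ := (mul_le_mul_right (hu x) _).trans_eq (mul_assoc _ _ _).symm
    calc F.coal μ N q u ≤ _ := hle
      _ ≤ (F.gamma μ q Set.univ ^ 2)⁻¹ * (C * F.gamma μ m Set.univ ^ 2) *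
          (2 * T * F.gamma μ q Set.univ ^ 2) := mul_le_mul_right hq _
      _ = ((F.gamma μ q Set.univ ^ 2)⁻¹ * F.gamma μ q Set.univ ^ 2) *
          (C * (2 * T) * F.gamma μ m Set.univ ^ 2) := by ring
      _ = _ := by rw [ENNReal.inv_mul_cancel h0' ht', one_mul]
  -- The constant `2T` reproduces itself: the product of means costs `T`, and the size of `N` keeps
  -- the sum of earlier terms below another `T`.
  have hS : ∀ q, q ≤ n → F.coal μ N q w ≤ 2 * T * F.gamma μ q Set.univ ^ 2 := by
    intro q
    induction q using Nat.strong_induction_on with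
    | _ q ih =>
      intro hq
      cases q with
      | zero =>
        have := hT 0
        rw [gamma_zero] at this ⊢
        simp only [measure_univ, mul_one, one_pow] at this ⊢
        exact this.trans (by rw [two_mul]; exact le_self_add)
      | succ p =>
        have hone := F.measurable_Qf (p + 1) (measurable_one (α := ℝ≥0∞) (β := X))
        have hexp := F.moment_le_sum μ (N := N) p hone (F.measurable_Qf (p + 1) hw)
        rw [← F.lintegral_gamma_succ μ p measurable_one, ← F.lintegral_gamma_succ μ p hw] at hexp
        have hsum : ∑ q ∈ Finset.range (p + 1), F.coal μ N q (fun x =>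
            F.sg q (p - q) (F.Qf (p + 1) 1) x * F.sg q (p - q) (F.Qf (p + 1) w) x) ≤
            (p + 1 : ℕ) * (C * (2 * T) * F.gamma μ (p + 1) Set.univ ^ 2) := by
          refine (Finset.sum_le_card_nsmul _ _ _ fun q hq' => ?_).trans_eq
            (by rw [Finset.card_range, nsmul_eq_mul])
          have hqp : q < p + 1 := Finset.mem_range.1 hq'
          -- Coalescence occurs at `q ≤ p`, so at least one step separates it from time `p + 1`, as
          -- `h2` requires.
          refine hcoal q (p + 1) _ (fun x => ?_) (ih q hqp (by omega))
          have e1 := F.sg_Qf q (p - q) 1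
          have e2 := F.sg_Qf q (p - q) w
          rw [show q + (p - q) + 1 = p + 1 by omega] at e1 e2
          rw [e1, e2]
          have := h2 q (p - q) x
          rwa [show q + (p - q + 1) = p + 1 by omega] at this
        change F.moment μ N p _ _ ≤ _
        calc F.moment μ N p (F.Qf (p + 1) 1) (F.Qf (p + 1) w) ≤ _ := hexp
          _ ≤ F.gamma μ (p + 1) Set.univ * (T * F.gamma μ (p + 1) Set.univ) +
              (N : ℝ≥0∞)⁻¹ * ((p + 1 : ℕ) * (C * (2 * T) * F.gamma μ (p + 1) Set.univ ^ 2)) := by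
            refine add_le_add (mul_le_mul' ?_ (hT _)) (mul_le_mul_right hsum _)
            simp
          _ = T * F.gamma μ (p + 1) Set.univ ^ 2 + ((N : ℝ≥0∞)⁻¹ * (p + 1 : ℕ) * (2 * C)) *
              (T * F.gamma μ (p + 1) Set.univ ^ 2) := by ring
          _ ≤ T * F.gamma μ (p + 1) Set.univ ^ 2 + 1 * (T * F.gamma μ (p + 1) Set.univ ^ 2) := by
            refine add_le_add_right (mul_le_mul_left (le_trans ?_ hN) _) _
            gcongr
            omega
          _ = _ := by ring
  refine (F.moment_le_sum μ (N := N) n measurable_one measurable_one).trans ?_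
  have hsum : ∑ q ∈ Finset.range (n + 1), F.coal μ N q (fun x =>
      F.sg q (n - q) 1 x * F.sg q (n - q) 1 x) ≤
      (n + 1 : ℕ) * (C * (2 * T) * F.gamma μ n Set.univ ^ 2) := by
    refine (Finset.sum_le_card_nsmul _ _ _ fun q hq' => ?_).trans_eq
      (by rw [Finset.card_range, nsmul_eq_mul])
    have hqn : q ≤ n := Nat.lt_succ_iff.1 (Finset.mem_range.1 hq')
    refine hcoal q n _ (fun x => ?_) (hS q hqn)
    have := h1 q (n - q) x
    rwa [show q + (n - q) = n by omega] at this
  refine (add_le_add_right (mul_le_mul_right hsum _) _).trans_eq ?_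
  simp only [Pi.one_apply, lintegral_one]
  ring

/-! ### From second moments to the relative variance, and the theorem. -/

lemma BoundedBy.gammaN_univ_le {F : Model X} {Gbar : ℝ} (hG : F.BoundedBy Gbar) {N : ℕ}
    [NeZero N] (n : ℕ) (ω : ℕ → Fin N → X) :
    F.gammaN n ω Set.univ ≤ ENNReal.ofReal Gbar ^ n := by
  rw [Model.gammaN, Measure.smul_apply, measure_univ, smul_eq_mul, mul_one]
  refine (Finset.prod_le_pow_card _ _ (ENNReal.ofReal Gbar) fun p _ => ?_).trans_eq
    (by rw [Finset.card_range])
  calc _ ≤ ∫⁻ _, ENNReal.ofReal Gbar ∂(empirical (ω p)) :=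
        lintegral_mono fun x => ENNReal.ofReal_le_ofReal (hG p x)
    _ = _ := by simp

/-- The relative variance of the unbiased estimate `γ_n^N(1)`, from a bound on its second
moment. -/
lemma integrable_and_integral_sq_le {F : Model X} {Gbar : ℝ} (hG : F.BoundedBy Gbar)
    (μ : Measure X) [IsProbabilityMeasure μ] (N : ℕ) [NeZero N] (n : ℕ)
    (h0 : F.gamma μ n Set.univ ≠ 0) {κ : ℝ} (hκ : 0 ≤ κ)
    (h : F.moment μ N n 1 1 ≤ F.gamma μ n Set.univ ^ 2 +
      ENNReal.ofReal κ * F.gamma μ n Set.univ ^ 2) :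
    Integrable (fun ω => ((F.gammaN n ω).real Set.univ / (F.gamma μ n).real Set.univ - 1) ^ 2)
        (F.particleLaw μ N) ∧
      ∫ ω, ((F.gammaN n ω).real Set.univ / (F.gamma μ n).real Set.univ - 1) ^ 2
        ∂(F.particleLaw μ N) ≤ κ := by
  have ht := hG.gamma_univ_ne_top μ n
  set g := (F.gamma μ n).real Set.univ with hg
  have hgpos : 0 < g := ENNReal.toReal_pos h0 ht
  have hmE : Measurable fun ω : ℕ → Fin N → X => F.gammaN n ω Set.univ := by
    have := F.measurable_lintegral_gammaN (N := N) n (measurable_one (α := ℝ≥0∞) (β := X))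
    simpa using this
  have hm : Measurable fun ω : ℕ → Fin N → X => (F.gammaN n ω).real Set.univ := hmE.ennreal_toReal
  have hfin : ∀ ω : ℕ → Fin N → X, F.gammaN n ω Set.univ ≠ ∞ := fun ω =>
    ne_top_of_le_ne_top (ENNReal.pow_ne_top ENNReal.ofReal_ne_top) (hG.gammaN_univ_le n ω)
  have hbd : ∀ ω : ℕ → Fin N → X, ‖(F.gammaN n ω).real Set.univ‖ ≤
      (ENNReal.ofReal Gbar ^ n).toReal := fun ω => by
    rw [Real.norm_of_nonneg measureReal_nonneg]
    exact ENNReal.toReal_mono (ENNReal.pow_ne_top ENNReal.ofReal_ne_top) (hG.gammaN_univ_le n ω)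
  have hi : Integrable (fun ω => (F.gammaN n ω).real Set.univ) (F.particleLaw μ N) :=
    Integrable.of_bound hm.aestronglyMeasurable _ (Filter.Eventually.of_forall hbd)
  have hi2 : Integrable (fun ω => (F.gammaN n ω).real Set.univ ^ 2) (F.particleLaw μ N) :=
    Integrable.of_bound (hm.pow_const 2).aestronglyMeasurable
      ((ENNReal.ofReal Gbar ^ n).toReal ^ 2) (Filter.Eventually.of_forall fun ω => by
        rw [norm_pow]; exact pow_le_pow_left₀ (norm_nonneg _) (hbd ω) 2)
  have hmean : ∫ ω, (F.gammaN n ω).real Set.univ ∂(F.particleLaw μ N) = g := by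
    have := F.lintegral_lintegral_gammaN μ (N := N) n (measurable_one (α := ℝ≥0∞) (β := X))
    simp only [Pi.one_apply, lintegral_one] at this
    rw [hg, Measure.real, ← this]
    exact integral_toReal hmE.aemeasurable
      (Filter.Eventually.of_forall fun ω => (hfin ω).lt_top)
  have hsq : ∫ ω, (F.gammaN n ω).real Set.univ ^ 2 ∂(F.particleLaw μ N) ≤ g ^ 2 + κ * g ^ 2 := by
    have hmom : F.moment μ N n 1 1 = ∫⁻ ω, F.gammaN n ω Set.univ ^ 2 ∂(F.particleLaw μ N) := by
      unfold Model.moment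
      refine lintegral_congr fun ω => ?_
      simp [sq]
    have hE : ∫ ω, (F.gammaN n ω).real Set.univ ^ 2 ∂(F.particleLaw μ N) =
        (F.moment μ N n 1 1).toReal := by
      rw [hmom, ← integral_toReal (hmE.pow_const 2).aemeasurable
        (Filter.Eventually.of_forall fun ω => (ENNReal.pow_ne_top (hfin ω)).lt_top)]
      simp only [ENNReal.toReal_pow, Measure.real]
    have ht2 : F.gamma μ n Set.univ ^ 2 ≠ ∞ := ENNReal.pow_ne_top ht
    have ht3 : ENNReal.ofReal κ * F.gamma μ n Set.univ ^ 2 ≠ ∞ :=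
      ENNReal.mul_ne_top ENNReal.ofReal_ne_top ht2
    rw [hE]
    refine (ENNReal.toReal_mono (ENNReal.add_ne_top.2 ⟨ht2, ht3⟩) h).trans_eq ?_
    rw [ENNReal.toReal_add ht2 ht3, ENNReal.toReal_mul, ENNReal.toReal_ofReal hκ,
      ENNReal.toReal_pow]
    rfl
  have hexp : ∀ ω : ℕ → Fin N → X, ((F.gammaN n ω).real Set.univ / g - 1) ^ 2 =
      (1 / g ^ 2) * (F.gammaN n ω).real Set.univ ^ 2 -
        (2 / g) * (F.gammaN n ω).real Set.univ + 1 := fun ω => by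
    field_simp; ring
  simp_rw [hexp]
  have hA : Integrable (fun ω => 1 / g ^ 2 * (F.gammaN n ω).real Set.univ ^ 2 -
      2 / g * (F.gammaN n ω).real Set.univ) (F.particleLaw μ N) :=
    (hi2.const_mul (1 / g ^ 2)).sub (hi.const_mul (2 / g))
  refine ⟨hA.add (integrable_const 1), ?_⟩
  rw [integral_add hA (integrable_const 1),
    integral_sub (hi2.const_mul (1 / g ^ 2)) (hi.const_mul (2 / g)), integral_const_mul,
    integral_const_mul, hmean, integral_const, probReal_univ, one_smul]
  have : 1 / g ^ 2 * ∫ ω, (F.gammaN n ω).real Set.univ ^ 2 ∂(F.particleLaw μ N) ≤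
      1 / g ^ 2 * (g ^ 2 + κ * g ^ 2) := mul_le_mul_of_nonneg_left hsq (by positivity)
  have e1 : 1 / g ^ 2 * (g ^ 2 + κ * g ^ 2) = 1 + κ := by field_simp
  have e2 : 2 / g * g = 2 := by field_simp
  linarith

end Model

end ParticleFK
end

theorem proposition7 {X : Type*} [TopologicalSpace X] [PolishSpace X] [NoncompactSpace X]
    [MeasurableSpace X] [BorelSpace X]
    (μ : Measure X) [IsProbabilityMeasure μ]
    (V : X → ℝ) (δ dlow : ℝ) (b εm εp : ℝ → ℝ) (ν : ℝ → Measure X) (Gbar : ℝ) :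
    ∃ c : ℝ, 0 < c ∧ ∀ F : ParticleFK.Model X,
      F.Drift V δ dlow b → ParticleFK.MemPv V μ → F.Minor V dlow εm ν →
      F.Major V dlow εm εp ν → F.BoundedBy Gbar →
      ∀ (n : ℕ) (N : ℕ) [NeZero N], 1 ≤ n → c * ((n : ℝ) + 1) < (N : ℝ) →
        Integrable (fun ω => ((F.gammaN n ω).real Set.univ / (F.gamma μ n).real Set.univ - 1) ^ 2)
          (F.particleLaw μ N) ∧
        ∫ ω, ((F.gammaN n ω).real Set.univ / (F.gamma μ n).real Set.univ - 1) ^ 2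
            ∂(F.particleLaw μ N) ≤
          c * (4 / (N : ℝ)) * ((n : ℝ) + 1) * (∫ x, Real.exp (V x) ∂μ) ^ 2 := by
  -- The constant must precede the model. One admissible model suffices to certify the properties of
  -- the parameters used to build it; if none exists the claim is vacuous.
  by_cases hex : ∃ F : ParticleFK.Model X, F.Drift V δ dlow b ∧ ParticleFK.MemPv V μ ∧
      F.Minor V dlow εm ν
  swap
  · exact ⟨1, one_pos, fun F hD hμ hm => absurd ⟨F, hD, hμ, hm⟩ hex⟩
  obtain ⟨F₀, hD₀, hμ, hm₀⟩ := hex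
  obtain ⟨C, T, hC, hT, hF⟩ := ParticleFK.Model.exists_sg_mul_sg_le
    (εp := εp) (Gbar := Gbar) μ hD₀ hμ hm₀
  lift C to NNReal using hC
  lift T to NNReal using hT
  have hC0 : (0 : ℝ) ≤ C := C.2
  have hT0 : (0 : ℝ) ≤ T := T.2
  -- `2C` makes `N` large enough for the induction, `2CT` is the variance constant, and `1` ensures
  -- positivity.
  refine ⟨1 + 2 * C + 2 * C * T, by positivity, fun F hD _ hm hM hG n N _ _ hN => ?_⟩
  obtain ⟨h0, hw, h1, h2⟩ := hF F hD hm hM hG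
  have hNpos : (0 : ℝ) < N := by exact_mod_cast Nat.pos_of_ne_zero (NeZero.ne N)
  have hn0 : (0 : ℝ) ≤ n := Nat.cast_nonneg n
  have hcast : (N : ℝ≥0∞)⁻¹ * (n + 1 : ℕ) = ENNReal.ofReal ((N : ℝ)⁻¹ * (n + 1)) := by
    rw [ENNReal.ofReal_mul (by positivity), ENNReal.ofReal_inv_of_pos hNpos,
      ENNReal.ofReal_natCast]
    congr 1
    rw [← Nat.cast_succ, ENNReal.ofReal_natCast]
  have hNC : (N : ℝ≥0∞)⁻¹ * (n + 1 : ℕ) * (2 * (C : ℝ≥0∞)) ≤ 1 := by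
    have e : (2 * (C : ℝ≥0∞)) = ENNReal.ofReal (2 * C) := by
      rw [ENNReal.ofReal_mul zero_le_two]; simp
    rw [hcast, e, ← ENNReal.ofReal_mul (by positivity), ← ENNReal.ofReal_one]
    refine ENNReal.ofReal_le_ofReal ?_
    rw [mul_assoc, inv_mul_le_iff₀ hNpos]
    nlinarith [mul_nonneg hC0 hT0, mul_nonneg (mul_nonneg hC0 hT0) hn0]
  have hmom := F.moment_one_le μ (ParticleFK.measurable_expV hD.measurable (1 / 2)) h0
    (hG.gamma_univ_ne_top μ) hw h1 h2 N n hNC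
  have e : (N : ℝ≥0∞)⁻¹ * (n + 1 : ℕ) * ((C : ℝ≥0∞) * (2 * T)) =
      ENNReal.ofReal ((N : ℝ)⁻¹ * (n + 1) * (C * (2 * T))) := by
    rw [hcast, ENNReal.ofReal_mul (p := (N : ℝ)⁻¹ * (n + 1)) (by positivity),
      ENNReal.ofReal_mul hC0, ENNReal.ofReal_mul zero_le_two]
    simp
  rw [e] at hmom
  obtain ⟨hint, hle⟩ := ParticleFK.Model.integrable_and_integral_sq_le hG μ N n (h0 n)
    (by positivity) hmom
  refine ⟨hint, hle.trans ?_⟩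
  -- The dependence on `μ` is already inside `T`; the factors `4` and `μ(v)^2 ≥ 1` are slack.
  have hv1 : 1 ≤ ∫ x, Real.exp (V x) ∂μ := by
    have hi : Integrable (fun x => Real.exp (V x)) μ := by
      refine (lintegral_ofReal_ne_top_iff_integrable
        hD.measurable.exp.aestronglyMeasurable (.of_forall fun x => (Real.exp_pos _).le)).1 hμ.2.ne
    calc (1 : ℝ) = ∫ _, (1 : ℝ) ∂μ := by simp
      _ ≤ _ := integral_mono (integrable_const 1) hi fun x =>
        Real.one_le_exp (zero_le_one.trans (hD.one_le x))
  have hv2 : 1 ≤ (∫ x, Real.exp (V x) ∂μ) ^ 2 := one_le_pow₀ hv1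
  have hA : 0 ≤ (N : ℝ)⁻¹ * (n + 1) := by positivity
  calc (N : ℝ)⁻¹ * (n + 1) * (C * (2 * T))
      ≤ (1 + 2 * C + 2 * C * T) * (4 / (N : ℝ)) * ((n : ℝ) + 1) * 1 := by
        rw [show (1 + 2 * (C : ℝ) + 2 * C * T) * (4 / (N : ℝ)) * ((n : ℝ) + 1) * 1 =
          (N : ℝ)⁻¹ * (n + 1) * (4 * (1 + 2 * C + 2 * C * T)) by ring]
        refine mul_le_mul_of_nonneg_left ?_ hA
        nlinarith [mul_nonneg hC0 hT0]
    _ ≤ _ := mul_le_mul_of_nonneg_left hv2 (by positivity)
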